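/- **Server Cloud Scheduling.** An instance consists of a finite directed acyclic task graph $G=(\mathcal J,E)$ with exactly one source $\mathcal S$ and exactly one sink $\mathcal T$, processing times $p_s(j)\in\mathbb N_0$ on the server and $p_c(j)\in\mathbb N_0\cup\{\infty\}$ on the cloud for every job $j$, where $p_s(\mathcal S)=p_s(\mathcal T)=0$, $p_c(\mathcal S)=p_c(\mathcal T)=\infty$ and $p_c(j)<\infty$ for all other jobs, and communication delays $c(i,j)\in\mathbb N_0$ for $(i,j)\in E$. A schedule assigns every job to the server or to the cloud and gives it a completion time $C(j)\in\mathbb N_0$; let $p(j)$ be the processing time of $j$ at the place it is assigned to. The schedule is valid if any two distinct jobs $i,j$ on the server satisfy $C(i)\le C(j)-p(j)$ or $C(j)\le C(i)-p(i)$, and if every edge $(i,j)\in E$ satisfies $C(i)\le C(j)-p(j)$ when $i,j$ are assigned to the same place, and $C(i)+c(i,j)\le C(j)-p(j)$ otherwise. Its makespan is $C(\mathcal T)$ and its cost is the sum of $p_c(j)$ over the jobs $j$ on the cloud. A *point* is the pair (makespan, cost) of a valid schedule of finite cost; the *Pareto front* is the set of all points for which no other point is at least as good in both coordinates. For $\alpha>0$,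 a set $S$ of points is an *$\alpha$-approximation* of the Pareto front if for every point $(m,b)$ of the front there is $(m',b')\in S$ with $m'\le(1+\alpha)m$ and $b'\le(1+\alpha)b$. Finally, let $$\varphi(G)=\max_{A}\,\bigl|\{(j,k)\in E : j\in A,\ k\notin A\}\bigr|,$$ where $A$ ranges over the sets of jobs that contain $\mathcal S$ and are not entered by any edge from $\mathcal J\setminus A$. **Theorem.** For every constant $k$ there is a deterministic algorithm which, for every real $\alpha>0$ and every instance with $\varphi(G)\le k$, given the instance (with all numbers in binary) and the integer $\lceil 1/\alpha\rceil$, outputs a finite list of points that is an $\alpha$-approximation of the Pareto front, in time polynomial in the length of the instance and in $\lceil 1/\alpha\rceil$. In particular, for every fixed $\alpha>0$ the running time is polynomial in the length of the instance. (Time is the bit-sensitive running time of a structured program on binary numbers and pairs, in which every primitive operation is charged the square of the length of the data it reads and writes.) -/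

import Mathlib

/-! ## A sequential programming language with a bit-sensitive running time -/

/-- Data handled by programs: natural numbers (stored in binary) and pairs. -/
inductive Val where
  | num (m : ℕ) : Val
  | pair (x y : Val) : Val

namespace Val

/-- Length of the representation of a datum, numbers being written in binary. -/
def size : Val → ℕ
  | num m => Nat.size m + 1
  | pair x y => x.size + y.size + 1

/-- Lists of data: the empty list is the number `0`, and a nonempty list is the pair of
its head and its tail. -/
def list : List Val → Val
  | [] => num 0
  | x :: l => pair x (list l)

end Val

/-- Primitive operations. -/
inductive Op where
  | id | const (v : Val) | fst | snd | isNum | add | sub | mul | div | le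

/-- Effect of a primitive operation; `none` means that it is not applicable. -/
def Op.apply : Op → Val → Option Val
  | .id, x => some x
  | .const v, _ => some v
  | .fst, .pair x _ => some x
  | .snd, .pair _ y => some y
  | .isNum, .num _ => some (.num 1)
  | .isNum, .pair _ _ => some (.num 0)
  | .add, .pair (.num a) (.num b) => some (.num (a + b))
  | .sub, .pair (.num a) (.num b) => some (.num (a - b))
  | .mul, .pair (.num a) (.num b) => some (.num (a * b))
  | .div, .pair (.num a) (.num b) => some (.num (a / b))
  | .le, .pair (.num a) (.num b) => some (.num (if a ≤ b then 1 else 0))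
  | _, _ => none

/-- Deterministic structured programs transforming one datum into another. -/
inductive Prog where
  /-- a primitive operation -/
  | prim (o : Op) : Prog
  /-- run both programs on (a copy of) the input and pair the two results -/
  | both (p q : Prog) : Prog
  /-- sequential composition: first `p`, then `q` -/
  | seq (p q : Prog) : Prog
  /-- run `p` if the test `c` gives a nonzero number, and `q` if it gives zero -/
  | ite (c p q : Prog) : Prog
  /-- as long as the test `c` gives a nonzero number, replace the datum by its image under `p` -/
  | loop (c p : Prog) : Prog

/-- `Prog.Runs p x y t`: started on `x`, the program `p` halts with result `y` after time `t`.

A primitive operation is charged the square of the total length of all the data that it reads and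
writes, which covers the bit operations of schoolbook arithmetic.  Every control step is charged
the length of the datum, so that copying is paid for as well. -/
inductive Prog.Runs : Prog → Val → Val → ℕ → Prop
  | prim {o : Op} {x y : Val} (h : o.apply x = some y) :
      Prog.Runs (.prim o) x y ((x.size + y.size) ^ 2)
  | both {p q : Prog} {x y z : Val} {t u : ℕ} (hp : Prog.Runs p x y t) (hq : Prog.Runs q x z u) :
      Prog.Runs (.both p q) x (.pair y z) (t + u + x.size)
  | seq {p q : Prog} {x y z : Val} {t u : ℕ} (hp : Prog.Runs p x y t) (hq : Prog.Runs q y z u) :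
      Prog.Runs (.seq p q) x z (t + u + x.size)
  | ite_true {c p q : Prog} {x y : Val} {m t u : ℕ} (hm : m ≠ 0)
      (hc : Prog.Runs c x (.num m) t) (hp : Prog.Runs p x y u) :
      Prog.Runs (.ite c p q) x y (t + u + x.size)
  | ite_false {c p q : Prog} {x y : Val} {t u : ℕ}
      (hc : Prog.Runs c x (.num 0) t) (hq : Prog.Runs q x y u) :
      Prog.Runs (.ite c p q) x y (t + u + x.size)
  | loop_stop {c p : Prog} {x : Val} {t : ℕ} (hc : Prog.Runs c x (.num 0) t) :
      Prog.Runs (.loop c p) x x (t + x.size)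
  | loop_step {c p : Prog} {x y z : Val} {m t u v : ℕ} (hm : m ≠ 0)
      (hc : Prog.Runs c x (.num m) t) (hp : Prog.Runs p x y u)
      (hl : Prog.Runs (.loop c p) y z v) :
      Prog.Runs (.loop c p) x z (t + u + v + x.size)

/-! ## Server Cloud Scheduling -/

namespace ServerCloud

/-- An instance of Server Cloud Scheduling with job set `Fin n`. -/
structure Problem where
  /-- number of jobs -/
  n : ℕ
  /-- `delay i j = some c` if `(i, j)` is an edge with communication delay `c`, and
  `delay i j = none` if `(i, j)` is not an edge of the task graph -/
  delay : Fin n → Fin n → Option ℕ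
  /-- the source of the task graph -/
  source : Fin n
  /-- the sink of the task graph -/
  sink : Fin n
  /-- processing times on the server -/
  procS : Fin n → ℕ
  /-- processing times on the cloud -/
  procC : Fin n → ℕ∞
  acyclic : ∀ j, ¬ Relation.TransGen (fun i k => (delay i k).isSome) j j
  source_iff : ∀ j, (∀ i, delay i j = none) ↔ j = source
  sink_iff : ∀ j, (∀ k, delay j k = none) ↔ j = sink
  procS_source : procS source = 0
  procS_sink : procS sink = 0
  procC_eq_top_iff : ∀ j, procC j = ⊤ ↔ j = source ∨ j = sink

namespace Problem

variable (I : Problem)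

/-- The edge relation of the task graph. -/
abbrev Edge (i j : Fin I.n) : Prop := (I.delay i j).isSome

/-- The sets of jobs that contain the source and are not entered by any edge from outside. -/
def dividingSets : Finset (Finset (Fin I.n)) :=
  {A | I.source ∈ A ∧ ∀ j k, I.Edge j k → j ∉ A → k ∉ A}

/-- The edges leading from `A` to its complement. -/
def cut (A : Finset (Fin I.n)) : Finset (Fin I.n × Fin I.n) :=
  {e | I.Edge e.1 e.2 ∧ e.1 ∈ A ∧ e.2 ∉ A}

/-- The maximum cardinality `φ` of a source and sink dividing cut. -/
def phi : ℕ := I.dividingSets.sup fun A => (I.cut A).card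

/-- A schedule: the jobs processed on the cloud (all others are processed on the server) and the
completion time of each job. -/
structure Schedule where
  cloud : Finset (Fin I.n)
  completion : Fin I.n → ℕ

variable {I}

namespace Schedule

variable (π : I.Schedule)

/-- The actual processing time of a job. -/
def proc (j : Fin I.n) : ℕ∞ := if j ∈ π.cloud then I.procC j else (I.procS j : ℕ∞)

/-- The communication delay that a delay `c` on the edge `(i, j)` amounts to. -/
def comm (i j : Fin I.n) (c : ℕ) : ℕ := if (i ∈ π.cloud ↔ j ∈ π.cloud) then 0 else c

/-- A schedule is valid if the server processes at most one job at a time, and if every job starts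
only after its predecessors are completed and the necessary communication is done. The inequality
`C i ≤ C j - p j` is written as `C i + p j ≤ C j`. -/
structure Valid : Prop where
  server : ∀ i j, i ∉ π.cloud → j ∉ π.cloud → i ≠ j →
    (π.completion i : ℕ∞) + π.proc j ≤ π.completion j ∨
      (π.completion j : ℕ∞) + π.proc i ≤ π.completion i
  precedence : ∀ i j c, I.delay i j = some c →
    (π.completion i : ℕ∞) + π.comm i j c + π.proc j ≤ π.completion j

/-- The makespan: completion time of the sink. -/
def makespan : ℕ := π.completion I.sink

/-- The cost: total processing time on the cloud. -/
def cost : ℕ∞ := ∑ j ∈ π.cloud, π.proc j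

end Schedule

variable (I)

/-- `(m, b)` is the pair (makespan, cost) of a feasible solution. -/
def IsPoint (p : ℕ × ℕ) : Prop :=
  ∃ π : I.Schedule, π.Valid ∧ π.makespan = p.1 ∧ π.cost = (p.2 : ℕ∞)

/-- The Pareto front: the points for which no other point is at least as good in both criteria. -/
def paretoFront : Set (ℕ × ℕ) := {p | Minimal I.IsPoint p}

/-- A set of (makespan, cost) points of feasible solutions is an `α`-approximation of the Pareto
front if it contains, for each point of the front, a point that is worse by a factor of at most
`1 + α` in each coordinate. -/
def ApproximatesFront (α : ℝ) (S : Set (ℕ × ℕ)) : Prop :=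
  (∀ p ∈ S, I.IsPoint p) ∧
    ∀ p ∈ I.paretoFront, ∃ q ∈ S, (q.1 : ℝ) ≤ (1 + α) * p.1 ∧ (q.2 : ℝ) ≤ (1 + α) * p.2

/-- The input given to an algorithm: number of jobs, source, sink, the two lists of processing
times, and the adjacency matrix with its delays. The value `∞` and a missing edge are written as
`0`, and a natural number `m` in these places as `m + 1`. -/
def encode : Val :=
  .list
    [.num I.n, .num I.source, .num I.sink,
      .list (List.ofFn fun j => .num (I.procS j)),
      .list (List.ofFn fun j => .num (if I.procC j = ⊤ then 0 else (I.procC j).toNat + 1)),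
      .list (List.ofFn fun i => .list (List.ofFn fun j =>
        .num (match I.delay i j with
          | none => 0
          | some c => c + 1)))]

end Problem

/-- A finite list of points as output of an algorithm. -/
def encodePoints (S : List (ℕ × ℕ)) : Val :=
  .list (S.map fun p => .pair (.num p.1) (.num p.2))

end ServerCloud

/-! The algorithm is a dynamic program over partial schedules, thinned out by rounding. A state
records which jobs are scheduled, the earliest start of every job on the server and on the cloud,
the completion time of the last server job, and the cost. One round schedules one more available job
at either place, and then drops every state dominated, up to a factor `1 + 1 / K` in each number, by
a state already kept. Here `K = 2 * n * L` with `L = ⌈1 / α⌉`.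

Soundness: numbers are compared approximately but never rounded, so each kept state describes a
genuine partial schedule (`Realizes.move`), and after `n` rounds it yields a point
(`Realizes.isPoint`).

Completeness: take the jobs of a given schedule by completion time, with ties broken suitably
(`IsPlan.exists_next`). Some kept state follows this order, and each trimming costs at most a factor
`1 + 1 / K` (`exists_tracks`). Over `n` rounds the loss is at most `1 + 1 / L ≤ 1 + α`
(`one_add_pow_le`).

Number of states: a nonempty set of scheduled jobs closed under predecessors is determined by its
cut (`mem_of_mem_of_cut_eq`), which has at most `k` edges, and only the heads of cut edges can have
nonzero ready times. All numbers have polynomial length, so they occupy polynomially many geometric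
intervals (`cell_lt`). Kept states have distinct signatures, so for fixed `k` there are polynomially
many (`length_rounds_le`).

Running time: `PT` is closed under composition, pairing, branching and folds whose intermediate
results stay polynomially long. The bound on the state lists holds only when the maximum cut is at
most `k`, so the outermost fold is treated with `PTm` on the subtype `BoundedCut k`. -/

open Polynomial

/-! ## Polynomial-time functions on encoded data -/

/-- Types whose elements are represented by data of programs. -/
class Enc (α : Type) where
  /-- the datum representing an element -/
  enc : α → Val

open Enc

instance : Enc ℕ := ⟨.num⟩
instance {α β : Type} [Enc α] [Enc β] : Enc (α × β) := ⟨fun p => .pair (enc p.1) (enc p.2)⟩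
instance {α : Type} [Enc α] : Enc (List α) := ⟨fun l => Val.list (l.map enc)⟩
instance : Enc Bool := ⟨fun b => .num (if b then 1 else 0)⟩

theorem Polynomial.eval_nat_mono (P : ℕ[X]) {a b : ℕ} (h : a ≤ b) : P.eval a ≤ P.eval b := by
  rw [eval_eq_sum_range, eval_eq_sum_range]
  gcongr

theorem Val.size_pos (x : Val) : 1 ≤ x.size := by
  cases x <;> simp [Val.size]

/-- Writing is paid for, so a time bound is also a length bound. This is what makes polynomial time
compose: the second program's input is polynomially long. -/
theorem Prog.Runs.size_le {p : Prog} {x y : Val} {t : ℕ} (h : p.Runs x y t) : y.size ≤ t := by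
  induction h with
  | prim h =>
    rename_i x y
    have := Nat.le_self_pow two_ne_zero (x.size + y.size)
    omega
  | both => rename_i x _ _ _ _ _ _ _ _; simp only [Val.size]; have := Val.size_pos x; omega
  | seq => omega
  | ite_true => omega
  | ite_false => omega
  | loop_stop => omega
  | loop_step => omega

variable {α β γ σ : Type} [Enc α] [Enc β] [Enc γ] [Enc σ]

/-- The length of the representation of an element. -/
def esize (a : α) : ℕ := (enc a).size

theorem esize_num (m : ℕ) : esize m = Nat.size m + 1 := rfl
theorem esize_prod (p : α × β) : esize p = esize p.1 + esize p.2 + 1 := rfl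
theorem esize_nil : esize ([] : List α) = 1 := rfl
theorem esize_cons (a : α) (l : List α) : esize (a :: l) = esize a + esize l + 1 := rfl
theorem esize_bool (b : Bool) : esize b ≤ 2 := by cases b <;> decide

theorem length_lt_esize (l : List α) : l.length < esize l := by
  induction l with
  | nil => simp [esize_nil]
  | cons a l ih => simp only [esize_cons, List.length_cons]; omega

theorem esize_le_of_mem {a : α} {l : List α} (h : a ∈ l) : esize a < esize l := by
  induction l with
  | nil => simp at h
  | cons b l ih =>
    rw [esize_cons]
    rcases List.mem_cons.1 h with rfl | h
    · omega
    · have := ih h; omega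

theorem esize_list_le {l : List α} {B : ℕ} (h : ∀ a ∈ l, esize a ≤ B) :
    esize l ≤ l.length * (B + 1) + 1 := by
  induction l with
  | nil => simp [esize_nil]
  | cons b l ih =>
    have h1 := ih fun a ha => h a (by simp [ha])
    have h2 := h b (by simp)
    simp only [esize_cons, List.length_cons]
    nlinarith

theorem esize_append (l l' : List α) : esize (l ++ l') + 1 = esize l + esize l' := by
  induction l with
  | nil => simp [esize_nil]; omega
  | cons b l ih => simp only [List.cons_append, esize_cons]; omega

theorem esize_drop_le (l : List α) (i : ℕ) : esize (l.drop i) ≤ esize l := by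
  induction l generalizing i with
  | nil => simp
  | cons b l ih =>
    cases i with
    | zero => simp
    | succ i => have := ih i; simp only [List.drop_succ_cons, esize_cons]; omega

/-- A program computes `f` in time polynomial in the measure `μ` of the argument. -/
def PTm (μ : α → ℕ) (f : α → β) : Prop :=
  ∃ (p : Prog) (P : ℕ[X]), ∀ a, ∃ t, p.Runs (enc a) (enc (f a)) t ∧ t ≤ P.eval (μ a)

/-- A program computes `f` in time polynomial in the length of the argument. -/
@[fun_prop]
def PT (f : α → β) : Prop := PTm esize f

theorem PT.size_bound {f : α → β} (hf : PT f) : ∃ P : ℕ[X], ∀ a, esize (f a) ≤ P.eval (esize a) := by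
  obtain ⟨p, P, h⟩ := hf
  refine ⟨P, fun a => ?_⟩
  obtain ⟨t, h1, h2⟩ := h a
  exact h1.size_le.trans h2

theorem PT.of_op {f : α → β} (o : Op) (B : ℕ) (h : ∀ a, o.apply (enc a) = some (enc (f a)))
    (hs : ∀ a, esize (f a) ≤ B * esize a + B) : PT f := by
  refine ⟨.prim o, (X + C B * X + C B) ^ 2, fun a => ⟨_, .prim (h a), ?_⟩⟩
  simp only [eval_pow, eval_add, eval_X, eval_mul, eval_C]
  have := hs a
  unfold esize at *
  exact Nat.pow_le_pow_left (by omega) 2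

@[fun_prop]
theorem PT.id : PT (fun a : α => a) :=
  .of_op .id 1 (fun a => by simp [Op.apply]) fun a => by simp

@[fun_prop]
theorem PT.const (c : β) : PT (fun _ : α => c) :=
  .of_op (.const (enc c)) (esize c) (fun a => by simp [Op.apply]) fun a => by simp

theorem PTm.comp {μ : α → ℕ} {g : β → γ} {f : α → β} (hg : PT g) (hf : PTm μ f)
    (hμ : ∀ a, esize a ≤ μ a) : PTm μ (fun a => g (f a)) := by
  obtain ⟨p, P, hf⟩ := hf
  obtain ⟨q, Q, hg⟩ := hg
  refine ⟨.seq p q, P + Q.comp P + X, fun a => ?_⟩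
  obtain ⟨t, h1, h2⟩ := hf a
  obtain ⟨u, h3, h4⟩ := hg (f a)
  refine ⟨_, .seq h1 h3, ?_⟩
  simp only [eval_add, eval_comp, eval_X]
  have := Q.eval_nat_mono (h1.size_le.trans h2)
  have := hμ a
  unfold esize at *
  omega

@[fun_prop]
theorem PT.comp {g : β → γ} {f : α → β} (hg : PT g) (hf : PT f) : PT (fun a => g (f a)) :=
  PTm.comp hg hf fun _ => le_rfl

/-- Restriction to a class of arguments, measured by a quantity at least their length. -/
theorem PT.toPTm {δ : Type} [Enc δ] {f : α → β} (hf : PT f) {e : δ → α} {μ : δ → ℕ}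
    (he : ∀ d, enc (e d) = enc d) (hμ : ∀ d, esize d ≤ μ d) : PTm μ (fun d => f (e d)) := by
  obtain ⟨p, P, hf⟩ := hf
  refine ⟨p, P, fun d => ?_⟩
  obtain ⟨t, h1, h2⟩ := hf (e d)
  rw [he] at h1
  refine ⟨t, h1, h2.trans (P.eval_nat_mono ?_)⟩
  simp only [esize, he]
  exact hμ d

@[fun_prop]
theorem PT.mk {f : α → β} {g : α → γ} (hf : PT f) (hg : PT g) : PT (fun a => (f a, g a)) := by
  obtain ⟨p, P, hf⟩ := hf
  obtain ⟨q, Q, hg⟩ := hg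
  refine ⟨.both p q, P + Q + X, fun a => ?_⟩
  obtain ⟨t, h1, h2⟩ := hf a
  obtain ⟨u, h3, h4⟩ := hg a
  refine ⟨_, .both h1 h3, ?_⟩
  simp only [eval_add, eval_X]
  unfold esize at *
  omega

@[fun_prop]
theorem PT.fst {f : α → β × γ} (hf : PT f) : PT (fun a => (f a).1) :=
  PT.comp (g := Prod.fst) (.of_op .fst 1 (fun _ => rfl) fun a => by rw [esize_prod]; omega) hf

@[fun_prop]
theorem PT.snd {f : α → β × γ} (hf : PT f) : PT (fun a => (f a).2) :=
  PT.comp (g := Prod.snd) (.of_op .snd 1 (fun _ => rfl) fun a => by rw [esize_prod]; omega) hf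

@[fun_prop]
theorem PT.cond {c : α → Bool} {f g : α → β} (hc : PT c) (hf : PT f) (hg : PT g) :
    PT (fun a => bif c a then f a else g a) := by
  obtain ⟨r, R, hc⟩ := hc
  obtain ⟨p, P, hf⟩ := hf
  obtain ⟨q, Q, hg⟩ := hg
  refine ⟨.ite r p q, R + P + Q + X, fun a => ?_⟩
  obtain ⟨s, h5, h6⟩ := hc a
  obtain ⟨t, h1, h2⟩ := hf a
  obtain ⟨u, h3, h4⟩ := hg a
  simp only [eval_add, eval_X]
  unfold esize at *
  cases h : c a
  · exact ⟨_, .ite_false (by simpa [h, enc] using h5) h3, by omega⟩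
  · exact ⟨_, .ite_true (one_ne_zero) (by simpa [h, enc] using h5) h1, by omega⟩

/-! ### Arithmetic, Boolean and basic list operations in polynomial time -/

theorem Nat.size_add_le (a b : ℕ) : Nat.size (a + b) ≤ Nat.size a + Nat.size b + 1 := by
  rw [Nat.size_le]
  have h1 := Nat.lt_size_self a
  have h2 := Nat.lt_size_self b
  have h3 : 2 ^ a.size ≤ 2 ^ (a.size + b.size) := Nat.pow_le_pow_right (by norm_num) (by omega)
  have h4 : 2 ^ b.size ≤ 2 ^ (a.size + b.size) := Nat.pow_le_pow_right (by norm_num) (by omega)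
  rw [pow_succ]
  omega

theorem Nat.size_mul_le (a b : ℕ) : Nat.size (a * b) ≤ Nat.size a + Nat.size b := by
  rw [Nat.size_le, pow_add]
  exact Nat.mul_lt_mul'' (Nat.lt_size_self a) (Nat.lt_size_self b)

theorem Nat.size_le_self (a : ℕ) : Nat.size a ≤ a := by
  rw [Nat.size_le]
  exact Nat.lt_two_pow_self

@[fun_prop]
theorem PT.add {f g : α → ℕ} (hf : PT f) (hg : PT g) : PT (fun a => f a + g a) := by
  refine PT.comp (g := fun p : ℕ × ℕ => p.1 + p.2)
    (.of_op .add 1 (fun _ => rfl) fun a => ?_) (hf.mk hg)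
  simp only [esize_prod, esize_num]
  have := Nat.size_add_le a.1 a.2
  omega

@[fun_prop]
theorem PT.sub {f g : α → ℕ} (hf : PT f) (hg : PT g) : PT (fun a => f a - g a) := by
  refine PT.comp (g := fun p : ℕ × ℕ => p.1 - p.2)
    (.of_op .sub 1 (fun _ => rfl) fun a => ?_) (hf.mk hg)
  simp only [esize_prod, esize_num]
  have := Nat.size_le_size (Nat.sub_le a.1 a.2)
  omega

@[fun_prop]
theorem PT.mul {f g : α → ℕ} (hf : PT f) (hg : PT g) : PT (fun a => f a * g a) := by
  refine PT.comp (g := fun p : ℕ × ℕ => p.1 * p.2)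
    (.of_op .mul 1 (fun _ => rfl) fun a => ?_) (hf.mk hg)
  simp only [esize_prod, esize_num]
  have := Nat.size_mul_le a.1 a.2
  omega

@[fun_prop]
theorem PT.ble {f g : α → ℕ} (hf : PT f) (hg : PT g) : PT (fun a => Nat.ble (f a) (g a)) := by
  refine PT.comp (g := fun p : ℕ × ℕ => Nat.ble p.1 p.2)
    (.of_op .le 2 (fun a => ?_) fun a => ?_) (hf.mk hg)
  · simp [enc, Op.apply]
  · have := esize_bool (Nat.ble a.1 a.2)
    omega

@[fun_prop]
theorem PT.not {f : α → Bool} (hf : PT f) : PT (fun a => !(f a)) := by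
  have : PT (fun a => bif f a then false else true) := by fun_prop
  convert this using 2 with a
  cases f a <;> rfl

@[fun_prop]
theorem PT.and {f g : α → Bool} (hf : PT f) (hg : PT g) : PT (fun a => f a && g a) := by
  have : PT (fun a => bif f a then g a else false) := by fun_prop
  convert this using 2 with a
  cases f a <;> rfl

@[fun_prop]
theorem PT.or {f g : α → Bool} (hf : PT f) (hg : PT g) : PT (fun a => f a || g a) := by
  have : PT (fun a => bif f a then true else g a) := by fun_prop
  convert this using 2 with a
  cases f a <;> rfl

@[fun_prop]
theorem PT.beq {f g : α → ℕ} (hf : PT f) (hg : PT g) : PT (fun a => f a == g a) := by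
  have : PT (fun a => Nat.ble (f a) (g a) && Nat.ble (g a) (f a)) := by fun_prop
  convert this using 2 with a
  rw [Bool.eq_iff_iff, beq_iff_eq, Bool.and_eq_true, Nat.ble_eq, Nat.ble_eq]
  exact le_antisymm_iff

@[fun_prop]
theorem PT.beq_bool {f g : α → Bool} (hf : PT f) (hg : PT g) : PT (fun a => f a == g a) := by
  have : PT (fun a => bif f a then g a else !(g a)) := by fun_prop
  convert this using 2 with a
  cases f a <;> cases g a <;> rfl

@[fun_prop]
theorem PT.max {f g : α → ℕ} (hf : PT f) (hg : PT g) : PT (fun a => max (f a) (g a)) := by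
  have : PT (fun a => bif Nat.ble (f a) (g a) then g a else f a) := by fun_prop
  convert this using 2 with a
  by_cases h : f a ≤ g a
  · simp [Nat.ble_eq_true_of_le h, h]
  · have : Nat.ble (f a) (g a) = false := Bool.eq_false_iff.2 fun h' => h (Nat.le_of_ble_eq_true h')
    simp [this, le_of_not_ge h]

@[fun_prop]
theorem PT.cons {f : α → β} {g : α → List β} (hf : PT f) (hg : PT g) :
    PT (fun a => f a :: g a) := by
  refine PT.comp (g := fun p : β × List β => p.1 :: p.2)
    -- A nonempty list and the pair of its head and tail are the same datum, so the identity program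
    -- does the work.
    (.of_op .id 1 (fun _ => rfl) fun a => ?_) (hf.mk hg)
  simp only [esize_prod, esize_cons]
  omega

@[fun_prop]
theorem PT.isEmpty {f : α → List β} (hf : PT f) : PT (fun a => (f a).isEmpty) := by
  refine PT.comp (g := fun l : List β => l.isEmpty) (.of_op .isNum 2 (fun l => ?_) fun l => ?_) hf
  · cases l <;> rfl
  · have := esize_bool l.isEmpty
    omega

@[fun_prop]
theorem PT.tail {f : α → List β} (hf : PT f) : PT (fun a => (f a).tail) := by
  refine PT.comp (g := fun l : List β => l.tail) ?_ hf
  -- The empty list is the only list encoded by a number, so `isNum` tests emptiness.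
  refine ⟨.ite (.prim .isNum) (.prim .id) (.prim .snd), 3 * (2 * X + 3) ^ 2, fun l => ?_⟩
  simp only [eval_mul, eval_pow, eval_add, eval_X, eval_ofNat]
  cases l with
  | nil =>
    refine ⟨_, .ite_true one_ne_zero (.prim rfl) (.prim rfl), ?_⟩
    simp only [esize, enc, List.map_nil, Val.list, Val.size, List.tail_nil]
    decide
  | cons b l =>
    refine ⟨_, .ite_false (.prim rfl) (.prim rfl), ?_⟩
    simp only [esize, enc, List.map_cons, Val.list, Val.size, List.tail_cons]
    have : Nat.size 0 = 0 := rfl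
    rw [this]
    nlinarith

@[fun_prop]
theorem PT.headD {f : α → List β} {d : α → β} (hf : PT f) (hd : PT d) :
    PT (fun a => (f a).headD (d a)) := by
  refine PT.comp (g := fun p : List β × β => p.1.headD p.2) ?_ (hf.mk hd)
  refine ⟨.ite (.seq (.prim .fst) (.prim .isNum)) (.prim .snd) (.seq (.prim .fst) (.prim .fst)),
    5 * (2 * X + 3) ^ 2, fun p => ?_⟩
  obtain ⟨l, d⟩ := p
  simp only [eval_mul, eval_pow, eval_add, eval_X, eval_ofNat]
  have h0 : Nat.size 0 = 0 := rfl
  have h1 : Nat.size 1 = 1 := rfl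
  cases l with
  | nil =>
    refine ⟨_, .ite_true one_ne_zero (.seq (.prim rfl) (.prim rfl)) (.prim rfl), ?_⟩
    simp only [esize, enc, List.map_nil, Val.list, Val.size, List.headD_nil, h0, h1]
    nlinarith
  | cons b l =>
    refine ⟨_, .ite_false (.seq (.prim rfl) (.prim rfl)) (.seq (.prim rfl) (.prim rfl)), ?_⟩
    simp only [esize, enc, List.map_cons, Val.list, Val.size, List.headD_cons, h0]
    nlinarith

/-- Loops with a polynomial number of steps, all of whose intermediate data have polynomial
length. -/
theorem PTm.loop {μ : α → ℕ} {s : α → σ} {c : σ → Bool} {b : σ → σ} (hs : PTm μ s) (hc : PT c)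
    (hb : PT b) (hμ : ∀ a, esize a ≤ μ a) (N : α → ℕ) (R Q : ℕ[X])
    (hN : ∀ a, N a ≤ R.eval (μ a)) (hct : ∀ a, ∀ i < N a, c (b^[i] (s a)) = true)
    (hcf : ∀ a, c (b^[N a] (s a)) = false)
    (hQ : ∀ a, ∀ i ≤ N a, esize (b^[i] (s a)) ≤ Q.eval (μ a)) :
    PTm μ (fun a => b^[N a] (s a)) := by
  obtain ⟨ps, Ps, hs⟩ := hs
  obtain ⟨pc, Pc, hc⟩ := hc
  obtain ⟨pb, Pb, hb⟩ := hb
  set T : ℕ[X] := Pc.comp Q + Pb.comp Q + Q with hT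
  refine ⟨.seq ps (.loop pc pb), Ps + (R + 1) * T + X, fun a => ?_⟩
  -- Induction on the number `j` of iterations still to be done, since the derivation of a loop is
  -- built from its end.
  have key : ∀ j ≤ N a, ∃ t, (Prog.loop pc pb).Runs (enc (b^[N a - j] (s a)))
      (enc (b^[N a] (s a))) t ∧ t ≤ (j + 1) * T.eval (μ a) := by
    intro j
    induction j with
    | zero =>
      intro _
      obtain ⟨t, h1, h2⟩ := hc (b^[N a] (s a))
      rw [hcf a] at h1
      refine ⟨_, Prog.Runs.loop_stop (by simpa [enc] using h1), ?_⟩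
      have h3 := hQ a (N a) le_rfl
      have h4 := Pc.eval_nat_mono h3
      simp only [hT, eval_add, eval_comp]
      unfold esize at *
      simp only [zero_add, one_mul, Nat.sub_zero]
      omega
    | succ j ih =>
      intro hj
      obtain ⟨v, h5, h6⟩ := ih (by omega)
      set x := b^[N a - (j + 1)] (s a) with hx
      have hbx : b x = b^[N a - j] (s a) := by
        rw [hx, ← Function.iterate_succ_apply' b]
        congr 2
        omega
      obtain ⟨t, h1, h2⟩ := hc x
      obtain ⟨u, h3, h4⟩ := hb x
      rw [hct a _ (by omega)] at h1
      rw [hbx] at h3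
      refine ⟨_, .loop_step one_ne_zero (by simpa [enc] using h1) h3 h5, ?_⟩
      have h7 := hQ a (N a - (j + 1)) (by omega)
      have h8 := Pc.eval_nat_mono h7
      have h9 := Pb.eval_nat_mono h7
      rw [← hx] at h7 h8 h9
      have hTe : T.eval (μ a) = Pc.eval (Q.eval (μ a)) + Pb.eval (Q.eval (μ a)) + Q.eval (μ a) := by
        simp [hT]
      rw [add_one_mul (j + 1)]
      unfold esize at *
      omega
  obtain ⟨t, h1, h2⟩ := hs a
  obtain ⟨u, h3, h4⟩ := key (N a) le_rfl
  rw [Nat.sub_self] at h3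
  refine ⟨_, .seq h1 h3, ?_⟩
  simp only [eval_add, eval_mul, eval_one, eval_X]
  have h5 := Nat.mul_le_mul_right (T.eval (μ a)) (Nat.add_le_add_right (hN a) 1)
  have h6 := hμ a
  unfold esize at *
  omega

/-- One step of the evaluation of a fold. -/
def foldStep {α β σ : Type} (h : α → σ → β → σ) (d : β) (x : α × σ × List β) : α × σ × List β :=
  (x.1, bif x.2.2.isEmpty then x.2.1 else h x.1 x.2.1 (x.2.2.headD d), x.2.2.tail)

theorem foldStep_iterate {α β σ : Type} (h : α → σ → β → σ) (d : β) (a : α) (i : ℕ) (s : σ)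
    (l : List β) :
    (foldStep h d)^[i] (a, s, l) = (a, (l.take i).foldl (h a) s, l.drop i) := by
  induction i generalizing s l with
  | zero => simp
  | succ i ih =>
    rw [Function.iterate_succ_apply]
    cases l with
    | nil =>
      have : foldStep h d (a, s, []) = (a, s, []) := rfl
      rw [this, ih]
      simp
    | cons b l =>
      have : foldStep h d (a, s, b :: l) = (a, h a s b, l) := rfl
      rw [this, ih]
      simp

/-- Folds with intermediate results of polynomial length; the measure, the arguments and the
function that is folded may be restricted by an encoding-preserving map `e`. -/
theorem PTm.foldl {δ : Type} [Enc δ] {e : δ → α} {μ : δ → ℕ} (he : ∀ x, enc (e x) = enc x)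
    (hμ : ∀ x, esize x ≤ μ x) {f : α → List β} {g : α → σ} {h : α → σ → β → σ} (hf : PT f)
    (hg : PT g) (hh : PT (fun x : α × σ × β => h x.1 x.2.1 x.2.2)) (Q : ℕ[X])
    (hQ : ∀ x i, esize (((f (e x)).take i).foldl (h (e x)) (g (e x))) ≤ Q.eval (μ x)) :
    PTm μ (fun x => (f (e x)).foldl (h (e x)) (g (e x))) := by
  -- `foldStep` needs a default head. If `β` is empty, every list to be folded over is empty.
  by_cases hβ : Nonempty β
  · obtain ⟨d⟩ := hβ
    obtain ⟨Pf, hPf⟩ := hf.size_bound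
    have hb : PT (foldStep h d) := by
      unfold foldStep
      fun_prop
    have h1 : PTm μ (fun x => (e x, g (e x), f (e x))) :=
      PT.toPTm (f := fun a => (a, g a, f a)) (by fun_prop) he hμ
    have hsz : ∀ x, esize (e x) ≤ μ x := fun x => by
      have := hμ x
      simpa only [esize, he] using this
    have h2 := PTm.loop (c := fun x : α × σ × List β => !x.2.2.isEmpty) (b := foldStep h d) h1
      (by fun_prop) hb hμ (fun x => (f (e x)).length) Pf (X + Q + Pf + 2)
      (fun x => ((length_lt_esize _).le.trans (hPf _)).trans (Pf.eval_nat_mono (hsz x)))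
      (fun x i hi => by simp [foldStep_iterate, hi]) (fun x => by simp [foldStep_iterate])
      (fun x i _ => by
        rw [foldStep_iterate]
        simp only [esize_prod, eval_add, eval_X, eval_ofNat]
        have h3 := hsz x
        have h4 := hQ x i
        have h5 := (esize_drop_le (f (e x)) i).trans (hPf _)
        have h6 := Pf.eval_nat_mono (hsz x)
        omega)
    have h3 := PTm.comp (g := fun x : α × σ × List β => x.2.1) (by fun_prop) h2 hμ
    simpa [foldStep_iterate] using h3
  · have h1 : ∀ x, f (e x) = [] := fun x => by
      cases hfx : f (e x) with
      | nil => rfl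
      | cons b _ => exact absurd ⟨b⟩ hβ
    simp only [h1, List.foldl_nil]
    exact PT.toPTm hg he hμ

theorem PT.foldl {f : α → List β} {g : α → σ} {h : α → σ → β → σ} (hf : PT f)
    (hg : PT g) (hh : PT (fun x : α × σ × β => h x.1 x.2.1 x.2.2)) (Q : ℕ[X])
    (hQ : ∀ a i, esize (((f a).take i).foldl (h a) (g a)) ≤ Q.eval (esize a)) :
    PT (fun a => (f a).foldl (h a) (g a)) :=
  PTm.foldl (e := fun a => a) (fun _ => rfl) (fun _ => le_rfl) hf hg hh Q hQ

/-! ### List operations obtained from folds -/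

theorem esize_foldl_le {β : Type} (h : σ → β → σ) (R : ℕ) (l : List β)
    (hR : ∀ s, ∀ b ∈ l, esize (h s b) ≤ esize s + R) (s : σ) :
    esize (l.foldl h s) ≤ esize s + l.length * R := by
  induction l generalizing s with
  | nil => simp
  | cons b l ih =>
    simp only [List.foldl_cons, List.length_cons]
    have h1 := ih (fun s b hb => hR s b (by simp [hb])) (h s b)
    have h2 := hR s b (by simp)
    rw [add_one_mul]
    omega

/-- Folds each of whose steps lengthens the result by an amount that is polynomial in the length
of the parameters. -/
theorem PT.foldl_grow {f : α → List β} {g : α → σ} {h : α → σ → β → σ} (hf : PT f)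
    (hg : PT g) (hh : PT (fun x : α × σ × β => h x.1 x.2.1 x.2.2)) (R : ℕ[X])
    (hR : ∀ a s b, esize (h a s b) ≤ esize s + R.eval (esize a + esize b)) :
    PT (fun a => (f a).foldl (h a) (g a)) := by
  obtain ⟨Pf, hPf⟩ := hf.size_bound
  obtain ⟨Pg, hPg⟩ := hg.size_bound
  refine PT.foldl hf hg hh (Pg + Pf * R.comp (X + Pf)) fun a i => ?_
  simp only [eval_add, eval_mul, eval_comp, eval_X]
  refine (esize_foldl_le (h a) (R.eval (esize a + Pf.eval (esize a))) _ ?_ _).trans ?_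
  · intro s b hb
    refine (hR a s b).trans ?_
    gcongr
    apply Polynomial.eval_nat_mono
    gcongr
    exact (esize_le_of_mem (List.mem_of_mem_take hb)).le.trans (hPf a)
  · gcongr
    · exact hPg a
    · refine le_trans ?_ ((length_lt_esize (f a)).le.trans (hPf a))
      simp

@[fun_prop]
theorem PT.reverse {f : α → List β} (hf : PT f) : PT (fun a => (f a).reverse) := by
  have : PT (fun a => (f a).foldl (fun s b => b :: s) []) := by
    refine PT.foldl_grow (h := fun a s b => b :: s) hf (by fun_prop) (by fun_prop) (X + 1)
      fun a s b => ?_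
    simp only [esize_cons, eval_add, eval_X, eval_one]
    omega
  convert this using 2 with a
  simp

@[fun_prop]
theorem PT.append {f g : α → List β} (hf : PT f) (hg : PT g) : PT (fun a => f a ++ g a) := by
  have : PT (fun a => (f a).reverse.foldl (fun s b => b :: s) (g a)) := by
    refine PT.foldl_grow (h := fun a s b => b :: s) (by fun_prop) hg (by fun_prop) (X + 1)
      fun a s b => ?_
    simp only [esize_cons, eval_add, eval_X, eval_one]
    omega
  convert this using 2 with a
  simp

@[fun_prop]
theorem PT.flatMap {h : α → β → List γ} {f : α → List β}
    (hh : PT (fun p : α × β => h p.1 p.2)) (hf : PT f) : PT (fun a => (f a).flatMap (h a)) := by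
  have : PT (fun a => (f a).foldl (fun s b => s ++ h a b) []) := by
    obtain ⟨R, hR⟩ := hh.size_bound
    have hh' : PT (fun x : α × List γ × β => h x.1 x.2.2) :=
      hh.comp (f := fun x : α × List γ × β => (x.1, x.2.2)) (by fun_prop)
    refine PT.foldl_grow (h := fun a s b => s ++ h a b) hf (by fun_prop) (by fun_prop)
      (R.comp (X + 1)) fun a s b => ?_
    have h1 := hR (a, b)
    have h2 := esize_append s (h a b)
    simp only [eval_comp, eval_add, eval_X, eval_one]
    simp only [esize_prod] at h1
    rw [add_assoc] at h1 ⊢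
    omega
  convert this using 2 with a
  rw [List.flatMap_eq_foldl]

@[fun_prop]
theorem PT.map {h : α → β → γ} {f : α → List β} (hh : PT (fun p : α × β => h p.1 p.2))
    (hf : PT f) : PT (fun a => (f a).map (h a)) := by
  have : PT (fun a => (f a).flatMap (fun b => [h a b])) := by fun_prop
  convert this using 2 with a
  exact List.map_eq_flatMap

@[fun_prop]
theorem PT.all {h : α → β → Bool} {f : α → List β} (hh : PT (fun p : α × β => h p.1 p.2))
    (hf : PT f) : PT (fun a => (f a).all (h a)) := by
  have : PT (fun a => (f a).foldl (fun s b => s && h a b) true) := by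
    have hh' : PT (fun x : α × Bool × β => h x.1 x.2.2) :=
      hh.comp (f := fun x : α × Bool × β => (x.1, x.2.2)) (by fun_prop)
    refine PT.foldl_grow (h := fun a s b => s && h a b) hf (by fun_prop) (by fun_prop) 2
      fun a s b => ?_
    have := esize_bool (s && h a b)
    simp only [eval_ofNat]
    omega
  convert this using 2 with a
  have : ∀ (l : List β) (s : Bool), l.foldl (fun s b => s && h a b) s = (s && l.all (h a)) := by
    intro l
    induction l with
    | nil => simp
    | cons b l ih => intro s; simp [ih, Bool.and_assoc]
  simp [this]

@[fun_prop]
theorem PT.any {h : α → β → Bool} {f : α → List β} (hh : PT (fun p : α × β => h p.1 p.2))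
    (hf : PT f) : PT (fun a => (f a).any (h a)) := by
  have : PT (fun a => !((f a).all (fun b => !(h a b)))) := by fun_prop
  convert this using 2 with a
  simp [List.any_eq_not_all_not]

@[fun_prop]
theorem PT.length {f : α → List β} (hf : PT f) : PT (fun a => (f a).length) := by
  have : PT (fun a => (f a).foldl (fun s _ => s + 1) 0) := by
    refine PT.foldl_grow (h := fun a s b => s + 1) hf (by fun_prop) (by fun_prop) 2
      fun a s b => ?_
    have h1 := Nat.size_add_le s 1
    have h2 : Nat.size 1 = 1 := rfl
    simp only [eval_ofNat, esize_num]
    omega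
  convert this using 2 with a
  simp

theorem esize_range_le (m : ℕ) : esize (List.range m) ≤ m * (m + 2) + 1 := by
  refine (esize_list_le (B := m + 1) fun i hi => ?_).trans (by simp)
  have h1 := Nat.size_le_self i
  have h2 := List.mem_range.1 hi
  rw [esize_num]
  omega

-- The bound of the range is the length of a list and not an arbitrary number: `List.range m` is
-- exponentially long in the binary length of `m`.
@[fun_prop]
theorem PT.range_length {f : α → List β} (hf : PT f) : PT (fun a => List.range (f a).length) := by
  have h1 : ∀ l : List β, l.foldl (fun (s : List ℕ) _ => s ++ [s.length]) [] = List.range l.length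
      := by
    intro l
    induction l using List.reverseRecOn with
    | nil => rfl
    | append_singleton l b ih => simp [ih, List.range_succ]
  have : PT (fun a => (f a).foldl (fun (s : List ℕ) _ => s ++ [s.length]) []) := by
    obtain ⟨P, hP⟩ := hf.size_bound
    refine PT.foldl (h := fun a (s : List ℕ) b => s ++ [s.length]) hf (by fun_prop) (by fun_prop)
      (P * (P + 2) + 1) fun a i => ?_
    rw [h1]
    have h2 : ((f a).take i).length ≤ P.eval (esize a) := by
      refine le_trans ?_ ((length_lt_esize (f a)).le.trans (hP a))
      simp
    refine (esize_range_le _).trans ?_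
    simp only [eval_add, eval_mul, eval_ofNat, eval_one]
    gcongr
  simpa only [h1] using this

-- Counting down from a binary index could take exponentially many steps. The fold therefore runs
-- over the list itself, dropping an element while the counter is positive; an index beyond the
-- length leaves the empty list.
@[fun_prop]
theorem PT.getD {f : α → List β} {i : α → ℕ} {d : α → β} (hf : PT f) (hi : PT i) (hd : PT d) :
    PT (fun a => (f a).getD (i a) (d a)) := by
  have h1 : ∀ (l s : List β) (i : ℕ), (l.foldl (fun (s : ℕ × List β) _ =>
      (s.1 - 1, bif Nat.ble 1 s.1 then s.2.tail else s.2)) (i, s)) =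
        (i - l.length, s.drop (min i l.length)) := by
    intro l
    induction l with
    | nil => simp
    | cons b l ih =>
      intro s i
      cases i with
      | zero =>
        rw [List.foldl_cons]
        refine (ih s 0).trans ?_
        simp
      | succ i =>
        rw [List.foldl_cons]
        refine (ih s.tail i).trans ?_
        rw [List.length_cons, Nat.add_sub_add_right, Nat.succ_min_succ, List.drop_tail]
  have : PT (fun a => ((f a).foldl (fun (s : ℕ × List β) _ =>
      (s.1 - 1, bif Nat.ble 1 s.1 then s.2.tail else s.2)) (i a, f a)).2.headD (d a)) := by
    have : PT (fun a => (f a).foldl (fun (s : ℕ × List β) _ =>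
        (s.1 - 1, bif Nat.ble 1 s.1 then s.2.tail else s.2)) (i a, f a)) := by
      obtain ⟨P, hP⟩ := hf.size_bound
      obtain ⟨R, hR⟩ := hi.size_bound
      refine PT.foldl (h := fun a (s : ℕ × List β) _ =>
        (s.1 - 1, bif Nat.ble 1 s.1 then s.2.tail else s.2)) hf (by fun_prop) (by fun_prop)
        (R + P + 1) fun a j => ?_
      rw [h1]
      have h2 := (esize_drop_le (f a) (min (i a) ((f a).take j).length)).trans (hP a)
      have h3 := hR a
      have h4 := Nat.size_le_size (Nat.sub_le (i a) ((f a).take j).length)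
      simp only [esize_prod, esize_num, eval_add, eval_one] at *
      omega
    fun_prop
  convert this using 2 with a
  rw [h1]
  simp only [List.headD_eq_head?_getD, List.head?_drop, List.getD_eq_getElem?_getD]
  rcases le_total (i a) (f a).length with h | h
  · rw [min_eq_left h]
  · rw [min_eq_right h, List.getElem?_eq_none h, List.getElem?_eq_none le_rfl]

namespace ServerCloud

/-! ## The algorithm -/

/-- The status of a job: whether it has been scheduled, and the earliest times at which, as far as
the jobs scheduled so far are concerned, it can start on the server and on the cloud. The two
times are reset to `0` when the job is scheduled. -/
abbrev Entry := Bool × ℕ × ℕ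

/-- A state of the dynamic program: the status of all jobs, the completion time of the last job on
the server, and the cost. -/
abbrev State := List Entry × ℕ × ℕ

/-- An instance as given to the algorithm, with the accuracy. -/
abbrev Input := (ℕ × ℕ × ℕ × List ℕ × List ℕ × List (List ℕ) × ℕ) × ℕ

namespace Input

variable (x : Input)

/-- Processing times on the server. -/
def serverTimes : List ℕ := x.1.2.2.2.1

/-- Processing times on the cloud, increased by one. -/
def cloudTimes : List ℕ := x.1.2.2.2.2.1

/-- The adjacency matrix. -/
def matrix : List (List ℕ) := x.1.2.2.2.2.2.1

/-- An entry of the adjacency matrix. -/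
def delayAt (i j : ℕ) : ℕ := (x.matrix.getD i []).getD j 0

/-- The jobs. -/
def jobs : List ℕ := List.range x.matrix.length

/-- The reciprocal of the rounding precision. -/
def accuracy : ℕ := 2 * (x.1.1 * x.2)

end Input

/-- The status of a job. -/
def entry (σ : List Entry) (i : ℕ) : Entry := σ.getD i (false, 0, 0)

/-- Whether a job may be scheduled next, on the cloud if `cl` is true, else on the server. -/
def ready (x : Input) (σ : List Entry) (j : ℕ) (cl : Bool) : Bool :=
  !(entry σ j).1 && (x.jobs.all fun i => x.delayAt i j == 0 || (entry σ i).1) &&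
    (!cl || Nat.ble 1 (x.cloudTimes.getD j 0))

/-- The completion time of a job that is scheduled next. -/
def finish (x : Input) (s : State) (j : ℕ) (cl : Bool) : ℕ :=
  bif cl then (entry s.1 j).2.2 + (x.cloudTimes.getD j 0 - 1)
  else max (entry s.1 j).2.1 s.2.1 + x.serverTimes.getD j 0

/-- The status of job `i` after job `j` has been scheduled. -/
def updated (x : Input) (s : State) (j : ℕ) (cl : Bool) (i : ℕ) : Entry :=
  bif i == j then (true, 0, 0)
  else bif x.delayAt j i == 0 then entry s.1 i
  else ((entry s.1 i).1,
    max (entry s.1 i).2.1 (finish x s j cl + bif cl then x.delayAt j i - 1 else 0),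
    max (entry s.1 i).2.2 (finish x s j cl + bif cl then 0 else x.delayAt j i - 1))

/-- The state after job `j` has been scheduled. -/
def move (x : Input) (s : State) (j : ℕ) (cl : Bool) : State :=
  (x.jobs.map fun i => updated x s j cl i,
    bif cl then s.2.1 else finish x s j cl,
    bif cl then s.2.2 + (x.cloudTimes.getD j 0 - 1) else s.2.2)

/-- The possible next states. -/
def moves (x : Input) (s : State) : List State :=
  x.jobs.flatMap fun j => [false, true].flatMap fun cl =>
    bif ready x s.1 j cl then [move x s j cl] else []

/-- Comparison of numbers up to the rounding precision. -/
def roughLe (K a b : ℕ) : Bool := Nat.ble (K * a) ((K + 1) * b)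

/-- Comparison of states up to the rounding precision. -/
def dominates (x : Input) (a b : State) : Bool :=
  (x.jobs.all fun i => (entry a.1 i).1 == (entry b.1 i).1 &&
    (roughLe x.accuracy (entry a.1 i).2.1 (entry b.1 i).2.1 &&
      roughLe x.accuracy (entry a.1 i).2.2 (entry b.1 i).2.2)) &&
  (roughLe x.accuracy a.2.1 b.2.1 && roughLe x.accuracy a.2.2 b.2.2)

/-- Add a state unless it is dominated. -/
def insertState (x : Input) (kept : List State) (s : State) : List State :=
  bif kept.any fun a => dominates x a s then kept else s :: kept

/-- Drop states that are dominated by others. -/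
def trim (x : Input) (l : List State) : List State := l.foldl (insertState x) []

/-- One round of the dynamic program: schedule one more job, and drop dominated states. -/
def round (x : Input) (l : List State) : List State := trim x (l.flatMap fun s => moves x s)

/-- The state in which no job is scheduled. -/
def initial (x : Input) : State := (x.jobs.map fun _ => (false, 0, 0), 0, 0)

/-- The states after some rounds. -/
def rounds (x : Input) (m : ℕ) : List State := (round x)^[m] [initial x]

/-- The output of the algorithm. -/
def solve (x : Input) : List (ℕ × ℕ) := (rounds x x.matrix.length).map fun s => s.2

/-! ### Polynomial running time of the parts of the algorithm -/

section PT

variable {α : Type} [Enc α] {x : α → Input} {s s' : α → State} {l : α → List State} {i j : α → ℕ}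
  {cl : α → Bool} {σ : α → List Entry}

@[fun_prop]
theorem PT.serverTimes (hx : PT x) : PT (fun a => (x a).serverTimes) := by
  unfold Input.serverTimes; fun_prop

@[fun_prop]
theorem PT.cloudTimes (hx : PT x) : PT (fun a => (x a).cloudTimes) := by
  unfold Input.cloudTimes; fun_prop

@[fun_prop]
theorem PT.matrix (hx : PT x) : PT (fun a => (x a).matrix) := by
  unfold Input.matrix; fun_prop

@[fun_prop]
theorem PT.delayAt (hx : PT x) (hi : PT i) (hj : PT j) :
    PT (fun a => (x a).delayAt (i a) (j a)) := by
  unfold Input.delayAt; fun_prop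

@[fun_prop]
theorem PT.jobs (hx : PT x) : PT (fun a => (x a).jobs) := by
  unfold Input.jobs; fun_prop

@[fun_prop]
theorem PT.accuracy (hx : PT x) : PT (fun a => (x a).accuracy) := by
  unfold Input.accuracy; fun_prop

@[fun_prop]
theorem PT.entry (hσ : PT σ) (hi : PT i) : PT (fun a => entry (σ a) (i a)) := by
  unfold ServerCloud.entry; fun_prop

@[fun_prop]
theorem PT.ready (hx : PT x) (hσ : PT σ) (hj : PT j) (hcl : PT cl) :
    PT (fun a => ready (x a) (σ a) (j a) (cl a)) := by
  unfold ServerCloud.ready; fun_prop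

@[fun_prop]
theorem PT.finish (hx : PT x) (hs : PT s) (hj : PT j) (hcl : PT cl) :
    PT (fun a => finish (x a) (s a) (j a) (cl a)) := by
  unfold ServerCloud.finish; fun_prop

@[fun_prop]
theorem PT.updated (hx : PT x) (hs : PT s) (hj : PT j) (hcl : PT cl) (hi : PT i) :
    PT (fun a => updated (x a) (s a) (j a) (cl a) (i a)) := by
  unfold ServerCloud.updated; fun_prop

@[fun_prop]
theorem PT.move (hx : PT x) (hs : PT s) (hj : PT j) (hcl : PT cl) :
    PT (fun a => move (x a) (s a) (j a) (cl a)) := by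
  unfold ServerCloud.move; fun_prop

@[fun_prop]
theorem PT.moves (hx : PT x) (hs : PT s) : PT (fun a => moves (x a) (s a)) := by
  unfold ServerCloud.moves; fun_prop

@[fun_prop]
theorem PT.roughLe {K : α → ℕ} (hK : PT K) (hi : PT i) (hj : PT j) :
    PT (fun a => roughLe (K a) (i a) (j a)) := by
  unfold ServerCloud.roughLe; fun_prop

@[fun_prop]
theorem PT.dominates (hx : PT x) (hs : PT s) (hs' : PT s') :
    PT (fun a => dominates (x a) (s a) (s' a)) := by
  unfold ServerCloud.dominates; fun_prop

@[fun_prop]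
theorem PT.insertState (hx : PT x) (hl : PT l) (hs : PT s) :
    PT (fun a => insertState (x a) (l a) (s a)) := by
  unfold ServerCloud.insertState; fun_prop

@[fun_prop]
theorem PT.trim (hx : PT x) (hl : PT l) : PT (fun a => trim (x a) (l a)) := by
  refine PT.foldl_grow (h := fun a kept s => ServerCloud.insertState (x a) kept s) hl
    (by fun_prop) (by fun_prop) (X + 1) fun a kept s => ?_
  simp only [ServerCloud.insertState, eval_add, eval_X, eval_one]
  cases kept.any fun a' => ServerCloud.dominates (x a) a' s
  · simp only [cond_false, esize_cons]
    omega
  · simp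

@[fun_prop]
theorem PT.round (hx : PT x) (hl : PT l) : PT (fun a => round (x a) (l a)) := by
  unfold ServerCloud.round; fun_prop

@[fun_prop]
theorem PT.initial (hx : PT x) : PT (fun a => initial (x a)) := by
  unfold ServerCloud.initial; fun_prop

/-- The number of states could multiply with each round, so a bound `Q` on their total length has to
be supplied. The iteration is a fold over the rows of the matrix, whose contents are ignored, which
makes the number of rounds polynomial. -/
theorem PTm.solve {e : α → Input} {μ : α → ℕ} (he : ∀ a, enc (e a) = enc a)
    (hμ : ∀ a, esize a ≤ μ a) (Q : ℕ[X])
    (hQ : ∀ a, ∀ m ≤ (e a).matrix.length, esize (rounds (e a) m) ≤ Q.eval (μ a)) :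
    PTm μ (fun a => solve (e a)) := by
  have h := PTm.foldl (f := fun x : Input => x.matrix) (g := fun x : Input => [initial x])
    (h := fun x l _ => ServerCloud.round x l) he hμ (by fun_prop) (by fun_prop) (by fun_prop) Q
    fun a i => by
      rw [List.foldl_const]
      exact hQ a _ (List.length_take_le' _ _)
  simp only [List.foldl_const] at h
  exact PTm.comp (g := fun l : List State => l.map fun s => s.2) (by fun_prop) h hμ

end PT

/-! ## Correctness of the algorithm -/

namespace Problem

variable (I : Problem)

/-- The code of an optional delay. -/
def delayCode : Option ℕ → ℕ
  | none => 0
  | some c => c + 1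

/-- The input of the algorithm, before encoding. -/
def input (L : ℕ) : Input :=
  ((I.n, I.source, I.sink, List.ofFn I.procS,
    List.ofFn fun j => if I.procC j = ⊤ then 0 else (I.procC j).toNat + 1,
    List.ofFn fun i => List.ofFn fun j => delayCode (I.delay i j), 0), L)

/-- The processing time of a job on the cloud or on the server. -/
def time (j : Fin I.n) (cl : Bool) : ℕ := bif cl then (I.procC j).toNat else I.procS j

variable {I}

/-- The last component `0` of the tuple in `input` plays the part of the empty list that ends
`encode`. -/
theorem enc_input (L : ℕ) : enc (I.input L) = .pair I.encode (.num L) := by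
  simp only [enc, input, encode, Val.list, List.map_ofFn, Function.comp_def]
  congr! 13 with i j

theorem length_matrix (L : ℕ) : (I.input L).matrix.length = I.n := by
  simp [input, Input.matrix]

theorem mem_jobs {L i : ℕ} : i ∈ (I.input L).jobs ↔ i < I.n := by
  simp [Input.jobs, length_matrix]

theorem getD_ofFn {α : Type} {n : ℕ} (f : Fin n → α) (j : Fin n) (d : α) :
    (List.ofFn f).getD j d = f j := by
  simp [List.getD_eq_getElem?_getD]

theorem serverTimes_getD (L : ℕ) (j : Fin I.n) :
    (I.input L).serverTimes.getD j 0 = I.time j false :=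
  getD_ofFn _ _ _

theorem cloudTimes_getD (L : ℕ) (j : Fin I.n) :
    (I.input L).cloudTimes.getD j 0 = if I.procC j = ⊤ then 0 else I.time j true + 1 :=
  getD_ofFn (fun j => if I.procC j = ⊤ then 0 else (I.procC j).toNat + 1) j 0

theorem cloudTimes_getD_sub (L : ℕ) (j : Fin I.n) :
    (I.input L).cloudTimes.getD j 0 - 1 = I.time j true := by
  rw [cloudTimes_getD]
  split_ifs with h
  · simp [time, h]
  · rfl

theorem delayAt_input (L : ℕ) (i j : Fin I.n) :
    (I.input L).delayAt i j = delayCode (I.delay i j) := by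
  unfold Input.delayAt Input.matrix input
  simp only [getD_ofFn]

theorem wellFounded_edge : WellFounded I.Edge := by
  have : IsTrans (Fin I.n) (Relation.TransGen I.Edge) := ⟨fun _ _ _ => Relation.TransGen.trans⟩
  have : Std.Irrefl (Relation.TransGen I.Edge) := ⟨I.acyclic⟩
  exact Subrelation.wf (fun h => Relation.TransGen.single h)
    (Finite.wellFounded_of_trans_of_irrefl (Relation.TransGen I.Edge))

theorem wellFounded_edge_swap : WellFounded (fun j k => I.Edge k j) := by
  have : IsTrans (Fin I.n) (Relation.TransGen fun j k => I.Edge k j) :=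
    ⟨fun _ _ _ => Relation.TransGen.trans⟩
  have : Std.Irrefl (Relation.TransGen fun j k => I.Edge k j) :=
    ⟨fun j h => I.acyclic j (Relation.transGen_swap.1 h)⟩
  exact Subrelation.wf (r := Relation.TransGen fun j k => I.Edge k j)
    (fun h => Relation.TransGen.single h)
    (Finite.wellFounded_of_trans_of_irrefl (Relation.TransGen fun j k => I.Edge k j))

theorem exists_edge_to {j : Fin I.n} (h : j ≠ I.source) : ∃ i c, I.delay i j = some c := by
  by_contra! h'
  refine h ((I.source_iff j).1 fun i => ?_)
  rw [Option.eq_none_iff_forall_ne_some]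
  exact h' i

theorem exists_edge_from {j : Fin I.n} (h : j ≠ I.sink) : ∃ k c, I.delay j k = some c := by
  by_contra! h'
  refine h ((I.sink_iff j).1 fun k => ?_)
  rw [Option.eq_none_iff_forall_ne_some]
  exact h' k

/-- A topological numbering: the number of proper predecessors. -/
noncomputable def rank (j : Fin I.n) : ℕ := by
  classical exact (Finset.univ.filter fun i => Relation.TransGen I.Edge i j).card

theorem rank_lt {i j : Fin I.n} (h : I.Edge i j) : I.rank i < I.rank j := by
  classical
  refine Finset.card_lt_card (Finset.ssubset_iff_of_subset ?_ |>.2 ⟨i, ?_, ?_⟩)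
  · intro a ha
    simp only [Finset.mem_filter, Finset.mem_univ, true_and] at *
    exact ha.tail h
  · simpa using Relation.TransGen.single h
  · simpa using I.acyclic i

end Problem

/-! ### States described by flags and ready times, and the effect of a move -/

variable {I : Problem} {L : ℕ}

open Problem

/-- Whether a job has been scheduled. -/
def flag (s : State) (j : ℕ) : Bool := (entry s.1 j).1

/-- The ready time of a job on the cloud or on the server. -/
def readyTime (s : State) (j : ℕ) (cl : Bool) : ℕ :=
  bif cl then (entry s.1 j).2.2 else (entry s.1 j).2.1

theorem entry_map (f : ℕ → Entry) (i : Fin I.n) :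
    entry ((I.input L).jobs.map f) i = f i := by
  simp [entry, List.getD_eq_getElem?_getD, Input.jobs, length_matrix]

theorem entry_move (s : State) (j i : Fin I.n) (cl : Bool) :
    entry (move (I.input L) s j cl).1 i = updated (I.input L) s j cl i :=
  entry_map _ i

theorem finish_eq (s : State) (j : Fin I.n) (cl : Bool) :
    finish (I.input L) s j cl =
      max (readyTime s j cl) (bif cl then 0 else s.2.1) + I.time j cl := by
  unfold finish readyTime
  rw [serverTimes_getD, cloudTimes_getD_sub]
  cases cl <;> simp

theorem flag_move (s : State) (j i : Fin I.n) (cl : Bool) :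
    flag (move (I.input L) s j cl) i = true ↔ i = j ∨ flag s i = true := by
  unfold flag
  rw [entry_move]
  unfold updated
  by_cases h : i = j
  · simp [h]
  · have : ((i : ℕ) == (j : ℕ)) = false := by simpa [Fin.val_inj] using h
    rw [this]
    cases (I.input L).delayAt j i == 0 <;> simp [h]

theorem readyTime_move (s : State) (j i : Fin I.n) (cl cl' : Bool) :
    readyTime (move (I.input L) s j cl) i cl' =
      if i = j then 0 else match I.delay j i with
        | none => readyTime s i cl'
        | some c => max (readyTime s i cl')
            (finish (I.input L) s j cl + if cl = cl' then 0 else c) := by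
  unfold readyTime
  rw [entry_move]
  unfold updated
  by_cases h : i = j
  · simp [h]
  · have : ((i : ℕ) == (j : ℕ)) = false := by simpa [Fin.val_inj] using h
    rw [this, delayAt_input, if_neg h]
    cases I.delay j i with
    | none => simp [delayCode]
    | some c => cases cl <;> cases cl' <;> simp [delayCode]

theorem server_move (s : State) (j : Fin I.n) (cl : Bool) :
    (move (I.input L) s j cl).2.1 = bif cl then s.2.1 else finish (I.input L) s j cl := rfl

theorem cost_move (s : State) (j : Fin I.n) (cl : Bool) :
    (move (I.input L) s j cl).2.2 = s.2.2 + bif cl then I.time j cl else 0 := by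
  unfold move
  rw [cloudTimes_getD_sub]
  cases cl <;> simp

theorem ready_iff (s : State) (j : Fin I.n) (cl : Bool) :
    ready (I.input L) s.1 j cl = true ↔ flag s j = false ∧
      (∀ i, I.Edge i j → flag s i = true) ∧ (cl = true → I.procC j ≠ ⊤) := by
  unfold ready flag
  rw [Bool.and_eq_true, Bool.and_eq_true, and_assoc, Bool.not_eq_true', List.all_eq_true]
  refine and_congr_right fun _ => and_congr ?_ ?_
  · constructor
    · intro h i hij
      obtain ⟨c, hc⟩ := Option.isSome_iff_exists.1 hij
      simpa [delayAt_input, hc, delayCode] using h i (mem_jobs.2 i.2)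
    · intro h i hi
      have hij := h ⟨i, mem_jobs.1 hi⟩
      have hd := delayAt_input L ⟨i, mem_jobs.1 hi⟩ j
      cases hc : I.delay ⟨i, mem_jobs.1 hi⟩ j with
      | none => simp only [hc, delayCode] at hd; simp [hd]
      | some c => simp [hij (by simp [Edge, hc])]
  · rw [cloudTimes_getD]
    cases cl
    · simp
    · by_cases h : I.procC j = ⊤ <;> simp [h]

theorem mem_moves {s s' : State} : s' ∈ moves (I.input L) s ↔
    ∃ (j : Fin I.n) (cl : Bool), ready (I.input L) s.1 j cl = true ∧
      s' = move (I.input L) s j cl := by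
  simp only [moves, List.mem_flatMap, mem_jobs]
  constructor
  · rintro ⟨j, hj, cl, -, h⟩
    refine ⟨⟨j, hj⟩, cl, ?_⟩
    cases hr : ready (I.input L) s.1 j cl <;> simp_all
  · rintro ⟨j, cl, hr, h⟩
    refine ⟨j, j.2, cl, by cases cl <;> simp, ?_⟩
    simp [hr, h]

theorem roughLe_refl (K a : ℕ) : roughLe K a a = true := by
  simp [roughLe]
  gcongr
  simp

theorem dominates_refl (x : Input) (s : State) : dominates x s s = true := by
  simp [dominates, roughLe_refl]

theorem dominates_iff {a b : State} : dominates (I.input L) a b = true ↔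
    (∀ i : Fin I.n, flag a i = flag b i ∧
      ∀ cl, roughLe (I.input L).accuracy (readyTime a i cl) (readyTime b i cl) = true) ∧
    roughLe (I.input L).accuracy a.2.1 b.2.1 = true ∧
    roughLe (I.input L).accuracy a.2.2 b.2.2 = true := by
  unfold dominates flag readyTime
  rw [Bool.and_eq_true, Bool.and_eq_true, List.all_eq_true]
  refine and_congr_left fun _ => ⟨fun h i => ?_, fun h i hi => ?_⟩
  · have := h i (mem_jobs.2 i.2)
    simp only [Bool.and_eq_true, beq_iff_eq] at this
    exact ⟨this.1, fun cl => by cases cl; exacts [this.2.1, this.2.2]⟩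
  · have := h ⟨i, mem_jobs.1 hi⟩
    simp only [Bool.and_eq_true, beq_iff_eq]
    exact ⟨this.1, this.2 false, this.2 true⟩

/-! ### Trimming a list of states -/

section trim

variable (x : Input)

/-- Kept states are never removed, so a discarded state has a direct dominator among them; this
matters because rough domination is not transitive. The pairwise statement is one-sided, as only a
later state is tested against earlier ones. That suffices, since states with equal signatures
dominate each other. -/
theorem trim_spec (l : List State) : (∀ s ∈ trim x l, s ∈ l) ∧
    (∀ s ∈ l, ∃ a ∈ trim x l, dominates x a s = true) ∧
    (trim x l).Pairwise fun b a => dominates x a b = false := by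
  unfold trim
  induction l using List.reverseRecOn with
  | nil => simp
  | append_singleton l s ih =>
    obtain ⟨h1, h2, h3⟩ := ih
    rw [List.foldl_append, List.foldl_cons, List.foldl_nil]
    set kept := l.foldl (insertState x) []
    unfold insertState
    cases h : kept.any fun a => dominates x a s with
    | true =>
      rw [cond_true]
      refine ⟨fun a ha => by simp [h1 a ha], fun b hb => ?_, h3⟩
      rcases List.mem_append.1 hb with hb | hb
      · exact h2 b hb
      · obtain rfl : b = s := by simpa using hb
        simpa using h
    | false =>
      rw [cond_false]
      refine ⟨fun a ha => ?_, fun b hb => ?_, ?_⟩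
      · rcases List.mem_cons.1 ha with rfl | ha
        · simp
        · simp [h1 a ha]
      · rcases List.mem_append.1 hb with hb | hb
        · obtain ⟨a, ha, hab⟩ := h2 b hb
          exact ⟨a, by simp [ha], hab⟩
        · obtain rfl : b = s := by simpa using hb
          exact ⟨b, by simp, dominates_refl x b⟩
      · exact List.pairwise_cons.2 ⟨by simpa using h, h3⟩

end trim

theorem rounds_succ (x : Input) (m : ℕ) : rounds x (m + 1) = round x (rounds x m) :=
  Function.iterate_succ_apply' _ _ _

theorem mem_rounds_succ {m : ℕ} {s' : State} (h : s' ∈ rounds (I.input L) (m + 1)) :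
    ∃ s ∈ rounds (I.input L) m, ∃ (j : Fin I.n) (cl : Bool),
      ready (I.input L) s.1 j cl = true ∧ s' = move (I.input L) s j cl := by
  rw [rounds_succ] at h
  have h' := (trim_spec _ _).1 _ h
  obtain ⟨s, hs, h1⟩ := List.mem_flatMap.1 h'
  exact ⟨s, hs, mem_moves.1 h1⟩

theorem flag_initial (i : Fin I.n) : flag (initial (I.input L)) i = false := by
  unfold flag initial
  rw [entry_map]

theorem readyTime_initial (i : Fin I.n) (cl : Bool) :
    readyTime (initial (I.input L)) i cl = 0 := by
  unfold readyTime initial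
  rw [entry_map]
  cases cl <;> rfl

/-! ### Soundness -/

/-- The state `s` describes the partial schedule of the jobs in `A` with places `loc` and completion
times `C`. -/
structure Realizes (s : State) (A : Finset (Fin I.n)) (loc : Fin I.n → Bool) (C : Fin I.n → ℕ) :
    Prop where
  flag_iff : ∀ j : Fin I.n, flag s j = true ↔ j ∈ A
  closed : ∀ i j, I.Edge i j → j ∈ A → i ∈ A
  finite : ∀ j ∈ A, loc j = true → I.procC j ≠ ⊤
  server : ∀ i ∈ A, ∀ j ∈ A, loc i = false → loc j = false → i ≠ j →
    C i + I.time j false ≤ C j ∨ C j + I.time i false ≤ C i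
  precedence : ∀ i j c, I.delay i j = some c → j ∈ A →
    C i + (if loc i = loc j then 0 else c) + I.time j (loc j) ≤ C j
  le_readyTime : ∀ i j c, I.delay i j = some c → i ∈ A → j ∉ A → ∀ cl,
    C i + (if loc i = cl then 0 else c) ≤ readyTime s j cl
  readyTime_eq_zero : ∀ j, (j ∈ A ∨ ∀ i, I.Edge i j → i ∉ A) → ∀ cl, readyTime s j cl = 0
  le_server : ∀ i ∈ A, loc i = false → C i ≤ s.2.1
  cost_eq : s.2.2 = ∑ j ∈ A, bif loc j then I.time j (loc j) else 0

theorem realizes_initial :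
    Realizes (I := I) (initial (I.input L)) ∅ (fun _ => false) (fun _ => 0) where
  flag_iff j := by simp [flag_initial]
  closed := by simp
  finite := by simp
  server := by simp
  precedence := by simp
  le_readyTime := by simp
  readyTime_eq_zero j _ cl := readyTime_initial j cl
  le_server := by simp
  cost_eq := by simp [initial]

theorem readyTime_le_move (s : State) {j i : Fin I.n} (hij : i ≠ j) (cl cl' : Bool) :
    readyTime s i cl' ≤ readyTime (move (I.input L) s j cl) i cl' := by
  rw [readyTime_move, if_neg hij]
  cases I.delay j i with
  | none => exact le_rfl
  | some c => exact le_max_left _ _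

/-- The new job starts no earlier than its ready time, which covers all its predecessors, and on the
server no earlier than the end of the last server job. Its successors' ready times are raised
accordingly. -/
theorem Realizes.move {s : State} {A : Finset (Fin I.n)} {loc : Fin I.n → Bool} {C : Fin I.n → ℕ}
    (h : Realizes s A loc C) {j : Fin I.n} {cl : Bool}
    (hr : ready (I.input L) s.1 j cl = true) :
    j ∉ A ∧ Realizes (move (I.input L) s j cl) (insert j A) (Function.update loc j cl)
      (Function.update C j (finish (I.input L) s j cl)) := by
  obtain ⟨hj, hpred, hfin⟩ := (ready_iff s j cl).1 hr
  have hjA : j ∉ A := fun hA => by simp [(h.flag_iff j).2 hA] at hj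
  have hne : ∀ i ∈ A, i ≠ j := fun i hi e => hjA (e ▸ hi)
  have hpredA : ∀ i, I.Edge i j → i ∈ A := fun i hi => (h.flag_iff i).1 (hpred i hi)
  have hF := finish_eq (L := L) s j cl
  refine ⟨hjA, ?_, ?_, ?_, ?_, ?_, ?_, ?_, ?_, ?_⟩
  · intro i
    rw [flag_move, h.flag_iff, Finset.mem_insert]
  · intro i k hik hk
    rcases Finset.mem_insert.1 hk with rfl | hk
    · exact Finset.mem_insert_of_mem (hpredA i hik)
    · exact Finset.mem_insert_of_mem (h.closed i k hik hk)
  · intro i hi hl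
    rcases Finset.mem_insert.1 hi with rfl | hi
    · exact hfin (by simpa using hl)
    · exact h.finite i hi (by simpa [hne i hi] using hl)
  · have key : ∀ i ∈ A, loc i = false → cl = false →
        C i + I.time j false ≤ finish (I.input L) s j cl := by
      intro i hi hl hcl
      have := h.le_server i hi hl
      subst hcl
      rw [hF]
      simp only [cond_false]
      omega
    intro i hi k hk hli hlk hik
    rw [Finset.mem_insert] at hi hk
    rcases hi with rfl | hi <;> rcases hk with rfl | hk
    · exact absurd rfl hik
    · simp only [Function.update_self, ne_eq, hne k hk, not_false_eq_true,
        Function.update_of_ne] at hli hlk ⊢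
      exact Or.inr (key k hk hlk hli)
    · simp only [Function.update_self, ne_eq, hne i hi, not_false_eq_true,
        Function.update_of_ne] at hli hlk ⊢
      exact Or.inl (key i hi hli hlk)
    · simp only [ne_eq, hne i hi, hne k hk, not_false_eq_true, Function.update_of_ne] at hli hlk ⊢
      exact h.server i hi k hk hli hlk hik
  · intro i k c hik hk
    rcases Finset.mem_insert.1 hk with rfl | hk
    · have hi := hpredA i (by simp [Edge, hik])
      simp only [Function.update_self, ne_eq, hne i hi, not_false_eq_true, Function.update_of_ne]
      have := h.le_readyTime i k c hik hi hjA cl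
      omega
    · have hi := h.closed i k (by simp [Edge, hik]) hk
      simp only [ne_eq, hne i hi, hne k hk, not_false_eq_true, Function.update_of_ne]
      exact h.precedence i k c hik hk
  · intro i k c hik hi hk cl'
    simp only [Finset.mem_insert, not_or] at hk
    rcases Finset.mem_insert.1 hi with rfl | hi
    · rw [readyTime_move, if_neg hk.1, hik]
      simp
    · simp only [ne_eq, hne i hi, not_false_eq_true, Function.update_of_ne]
      exact (h.le_readyTime i k c hik hi hk.2 cl').trans (readyTime_le_move s hk.1 cl cl')
  -- A job that is scheduled or has no scheduled predecessor receives no update from `j`: by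
  -- closedness an edge from `j` cannot enter the old set.
  · intro i hi cl'
    rw [readyTime_move]
    by_cases hij : i = j
    · rw [if_pos hij]
    · have h1 : I.delay j i = none := by
        by_contra h2
        have h3 : I.Edge j i := Option.isSome_iff_ne_none.2 h2
        rcases hi with hi | hi
        · rcases Finset.mem_insert.1 hi with hi | hi
          · exact hij hi
          · exact hjA (h.closed j i h3 hi)
        · exact hi j h3 (Finset.mem_insert_self _ _)
      rw [if_neg hij, h1]
      refine h.readyTime_eq_zero i ?_ cl'
      rcases hi with hi | hi
      · exact Or.inl ((Finset.mem_insert.1 hi).resolve_left hij)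
      · exact Or.inr fun a ha ha' => hi a ha (Finset.mem_insert_of_mem ha')
  · intro i hi hl
    rw [server_move]
    rcases Finset.mem_insert.1 hi with rfl | hi
    · simp only [Function.update_self] at hl ⊢
      simp [hl]
    · simp only [ne_eq, hne i hi, not_false_eq_true, Function.update_of_ne] at hl ⊢
      have := h.le_server i hi hl
      cases cl
      · rw [cond_false, hF]
        simp only [cond_false]
        omega
      · exact this
  · rw [cost_move, Finset.sum_insert hjA, h.cost_eq, add_comm, Function.update_self]
    congr 1
    refine Finset.sum_congr rfl fun i hi => ?_
    simp [hne i hi]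

theorem exists_realizes {m : ℕ} {s : State} (hs : s ∈ rounds (I.input L) m) :
    ∃ (A : Finset (Fin I.n)) (loc : Fin I.n → Bool) (C : Fin I.n → ℕ),
      A.card = m ∧ Realizes s A loc C := by
  induction m generalizing s with
  | zero =>
    obtain rfl : s = initial (I.input L) := by simpa [rounds] using hs
    exact ⟨∅, _, _, rfl, realizes_initial⟩
  | succ m ih =>
    obtain ⟨s, hs', j, cl, hr, rfl⟩ := mem_rounds_succ hs
    obtain ⟨A, loc, C, hA, h⟩ := ih hs'
    obtain ⟨hj, h'⟩ := h.move hr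
    exact ⟨_, _, _, by rw [Finset.card_insert_of_notMem hj, hA], h'⟩

theorem Realizes.isPoint {s : State} {loc : Fin I.n → Bool} {C : Fin I.n → ℕ}
    (h : Realizes s Finset.univ loc C) : I.IsPoint s.2 := by
  have hsink : loc I.sink = false := by
    by_contra hl
    exact h.finite I.sink (Finset.mem_univ _) (by simpa using hl)
      ((I.procC_eq_top_iff _).2 (Or.inr rfl))
  have ht : I.time I.sink false = 0 := I.procS_sink
  have hC : C I.sink ≤ s.2.1 := h.le_server _ (Finset.mem_univ _) hsink
  -- The state reports the end of the server's work as makespan. The sink takes no time and has no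
  -- successor, so it can be postponed to exactly that moment.
  let π : I.Schedule := ⟨Finset.univ.filter fun j => loc j = true,
    Function.update C I.sink s.2.1⟩
  have hmem : ∀ j, j ∈ π.cloud ↔ loc j = true := fun j => by simp [π]
  have hproc : ∀ j, π.proc j = (I.time j (loc j) : ℕ∞) := by
    intro j
    unfold Schedule.proc
    simp only [hmem]
    cases hl : loc j
    · simp [time]
    · simp [time, ENat.natCast_toNat (h.finite j (Finset.mem_univ _) hl)]
  refine ⟨π, ⟨fun i j hi hj hij => ?_, fun i j c hc => ?_⟩, ?_, ?_⟩
  · rw [hproc, hproc]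
    rw [hmem, Bool.not_eq_true] at hi hj
    rw [hi, hj]
    norm_cast
    by_cases h1 : i = I.sink
    · subst h1
      right
      simp only [π, Function.update_self, Function.update_of_ne (Ne.symm hij), ht]
      exact h.le_server _ (Finset.mem_univ _) hj
    · by_cases h2 : j = I.sink
      · subst h2
        left
        simp only [π, Function.update_self, Function.update_of_ne hij, ht]
        exact h.le_server _ (Finset.mem_univ _) hi
      · simp only [π, Function.update_of_ne h1, Function.update_of_ne h2]
        exact h.server i (Finset.mem_univ _) j (Finset.mem_univ _) hi hj hij
  · have h1 : i ≠ I.sink := by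
      rintro rfl
      have := (I.sink_iff I.sink).2 rfl j
      simp [this] at hc
    have h2 : π.completion i = C i := by simp [π, h1]
    have h3 : C j ≤ π.completion j := by
      by_cases h4 : j = I.sink
      · subst h4
        simpa [π] using hC
      · simp [π, h4]
    have h5 := h.precedence i j c hc (Finset.mem_univ _)
    have h6 : π.comm i j c = if loc i = loc j then 0 else c := by
      unfold Schedule.comm
      simp only [hmem, Bool.coe_iff_coe]
    rw [hproc, h2, h6]
    exact_mod_cast h5.trans h3
  · simp [Schedule.makespan, π]
  · rw [h.cost_eq]
    unfold Schedule.cost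
    simp only [hproc]
    rw [Finset.sum_filter]
    push_cast
    refine Finset.sum_congr rfl fun j _ => ?_
    cases loc j <;> simp

theorem isPoint_of_mem_solve {p : ℕ × ℕ} (hp : p ∈ solve (I.input L)) : I.IsPoint p := by
  unfold solve at hp
  rw [length_matrix] at hp
  obtain ⟨s, hs, rfl⟩ := List.mem_map.1 hp
  obtain ⟨A, loc, C, hA, h⟩ := exists_realizes hs
  obtain rfl : A = Finset.univ := by
    rw [← Finset.card_eq_iff_eq_univ, hA, Fintype.card_fin]
  exact h.isPoint

/-! ### Completeness -/

/-- The data of a valid schedule of finite cost. -/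
structure IsPlan (loc : Fin I.n → Bool) (C : Fin I.n → ℕ) : Prop where
  finite : ∀ j, loc j = true → I.procC j ≠ ⊤
  server : ∀ i j, loc i = false → loc j = false → i ≠ j →
    C i + I.time j false ≤ C j ∨ C j + I.time i false ≤ C i
  precedence : ∀ i j c, I.delay i j = some c →
    C i + (if loc i = loc j then 0 else c) + I.time j (loc j) ≤ C j

theorem exists_isPlan {p : ℕ × ℕ} (hp : I.IsPoint p) :
    ∃ (loc : Fin I.n → Bool) (C : Fin I.n → ℕ), IsPlan loc C ∧ C I.sink = p.1 ∧
      (∑ j, bif loc j then I.time j (loc j) else 0) = p.2 := by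
  obtain ⟨π, hv, hm, hc⟩ := hp
  have hfin : ∀ j ∈ π.cloud, I.procC j ≠ ⊤ := by
    intro j hj h
    -- Finite cost excludes infinite processing times on the cloud; from there on everything is a
    -- natural number.
    have h1 : π.proc j ≤ π.cost :=
      Finset.single_le_sum (f := π.proc) (fun _ _ => zero_le) hj
    rw [hc] at h1
    simp [Schedule.proc, hj, h] at h1
  have hproc : ∀ j, π.proc j = (I.time j (decide (j ∈ π.cloud)) : ℕ∞) := by
    intro j
    unfold Schedule.proc
    by_cases hj : j ∈ π.cloud
    · simp [hj, time, ENat.natCast_toNat (hfin j hj)]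
    · simp [hj, time]
  refine ⟨fun j => decide (j ∈ π.cloud), π.completion, ⟨?_, ?_, ?_⟩, hm, ?_⟩
  · intro j hj
    exact hfin j (by simpa using hj)
  · intro i j hi hj hij
    have h := hv.server i j (by simpa using hi) (by simpa using hj) hij
    rw [hproc, hproc, hi, hj] at h
    exact_mod_cast h
  · intro i j c hij
    have h := hv.precedence i j c hij
    rw [hproc] at h
    have h1 : π.comm i j c = if decide (i ∈ π.cloud) = decide (j ∈ π.cloud) then 0 else c := by
      simp [Schedule.comm]
    rw [h1] at h
    exact_mod_cast h
  · have h : (π.cost : ℕ∞) = ((∑ j, bif decide (j ∈ π.cloud) then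
        I.time j (decide (j ∈ π.cloud)) else 0 : ℕ) : ℕ∞) := by
      unfold Schedule.cost
      simp only [hproc]
      push_cast
      rw [← Finset.sum_filter_add_sum_filter_not Finset.univ (fun j => j ∈ π.cloud),
        Finset.filter_mem_eq_inter, Finset.univ_inter]
      rw [Finset.sum_eq_zero (s := Finset.univ.filter fun j => j ∉ π.cloud)]
      · rw [add_zero]
        exact Finset.sum_congr rfl fun j hj => by simp [hj]
      · intro j hj
        have : j ∉ π.cloud := by simpa using hj
        simp [this]
    rw [hc] at h
    exact_mod_cast h.symm

namespace IsPlan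

variable {loc : Fin I.n → Bool} {C : Fin I.n → ℕ}

theorem source_eq (h : IsPlan loc C) : loc I.source = false := by
  by_contra hl
  exact h.finite _ (by simpa using hl) ((I.procC_eq_top_iff _).2 (Or.inl rfl))

/-- Start times are nonnegative: the source takes no time, and any other job waits for a
predecessor. -/
theorem time_le (h : IsPlan loc C) (j : Fin I.n) : I.time j (loc j) ≤ C j := by
  by_cases hj : j = I.source
  · subst hj
    rw [h.source_eq]
    simp [time, I.procS_source]
  · obtain ⟨i, c, hc⟩ := exists_edge_to hj
    have := h.precedence i j c hc
    omega

theorem le_sink (h : IsPlan loc C) (j : Fin I.n) : C j ≤ C I.sink := by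
  induction j using wellFounded_edge_swap.induction with
  | _ j ih =>
    by_cases hj : j = I.sink
    · rw [hj]
    · obtain ⟨k, c, hc⟩ := exists_edge_from hj
      have h1 := ih k (by simp [Edge, hc])
      have h2 := h.precedence j k c hc
      omega

/-- Some unscheduled job is the next one both in the order of the task graph and in the order on
the server. -/
theorem exists_next (h : IsPlan loc C) {A : Finset (Fin I.n)} (hA : A ≠ Finset.univ) :
    ∃ j ∉ A, (∀ i, I.Edge i j → i ∈ A) ∧
      (loc j = false → ∀ k ∉ A, k ≠ j → loc k = false → C j + I.time k false ≤ C k) := by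
  have hne : Aᶜ.Nonempty := by
    rwa [Finset.nonempty_iff_ne_empty, ne_eq, Finset.compl_eq_empty_iff]
  -- Completion times alone do not settle ties. At equal completion times, jobs of positive length
  -- precede those of length zero, as they must on the server; among the latter the topological rank
  -- respects the edges.
  obtain ⟨j, hj, hmin⟩ := Finset.exists_min_image Aᶜ
    (fun j => toLex (C j, toLex (if I.time j (loc j) = 0 then 1 else 0, I.rank j))) hne
  simp only [Finset.mem_compl, Prod.Lex.toLex_le_toLex] at hj hmin
  refine ⟨j, hj, fun i hij => ?_, fun hl k hk hkj hlk => ?_⟩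
  · by_contra hi
    obtain ⟨c, hc⟩ := Option.isSome_iff_exists.1 hij
    have h1 := h.precedence i j c hc
    have h2 := hmin i hi
    have h3 := rank_lt hij
    have h4 : I.time j (loc j) = 0 ∨ I.time j (loc j) ≠ 0 := em _
    split_ifs at h2 <;> omega
  · have h2 := hmin k hk
    rw [hl, hlk] at h2
    rcases h.server j k hl hlk hkj.symm with h1 | h1
    · exact h1
    · split_ifs at h2 <;> simp at h2 <;> omega

end IsPlan

/-- The state `s` is a partial schedule of the jobs in `A` that is at most by the factor `r` worse
than a given schedule. -/
structure Tracks (loc : Fin I.n → Bool) (C : Fin I.n → ℕ) (r : ℝ) (s : State)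
    (A : Finset (Fin I.n)) : Prop where
  flag_iff : ∀ j : Fin I.n, flag s j = true ↔ j ∈ A
  readyTime_le : ∀ j ∉ A, (readyTime s j (loc j) : ℝ) ≤ r * (C j - I.time j (loc j))
  server_le : ∀ j ∉ A, loc j = false → (s.2.1 : ℝ) ≤ r * (C j - I.time j (loc j))
  server_le_sink : (s.2.1 : ℝ) ≤ r * C I.sink
  cost_le : (s.2.2 : ℝ) ≤ r * (∑ j ∈ A, bif loc j then I.time j (loc j) else 0 : ℕ)

section Tracks

variable {loc : Fin I.n → Bool} {C : Fin I.n → ℕ} {r : ℝ} {s : State} {A : Finset (Fin I.n)}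

theorem tracks_initial (h : IsPlan loc C) : Tracks loc C 1 (initial (I.input L)) ∅ where
  flag_iff j := by simp [flag_initial]
  readyTime_le j _ := by
    rw [readyTime_initial]
    have := h.time_le j
    rify at this
    push_cast
    linarith
  server_le j _ _ := by
    simpa [initial] using h.time_le j
  server_le_sink := by simp [initial]
  cost_le := by simp [initial]

/-- Place the next job of the plan where the plan has it. A start of at most `r * (C j - p)` gives a
completion of at most `r * (C j - p) + p ≤ r * C j`, because `1 ≤ r`; so a move loses nothing. -/
theorem Tracks.exists_move (ht : Tracks loc C r s A) (h : IsPlan loc C) (hr : 1 ≤ r)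
    (hA : A ≠ Finset.univ) : ∃ j ∉ A, move (I.input L) s j (loc j) ∈ moves (I.input L) s ∧
      Tracks loc C r (move (I.input L) s j (loc j)) (insert j A) := by
  obtain ⟨j, hj, hpred, hnext⟩ := h.exists_next hA
  have hF : (finish (I.input L) s j (loc j) : ℝ) ≤ r * C j := by
    rw [finish_eq]
    have h1 := ht.readyTime_le j hj
    have h2 : ((bif loc j then 0 else s.2.1 : ℕ) : ℝ) ≤ r * (C j - I.time j (loc j)) := by
      cases hl : loc j with
      | false => simpa [hl] using ht.server_le j hj hl
      | true =>
        rw [← hl]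
        have := h.time_le j
        rify at this
        have h3 : (0 : ℝ) ≤ r * (C j - I.time j (loc j)) :=
          mul_nonneg (by linarith) (by linarith)
        simpa [hl] using h3
    push_cast
    have h4 := max_le h1 h2
    have h5 : (0 : ℝ) ≤ I.time j (loc j) := Nat.cast_nonneg _
    nlinarith
  refine ⟨j, hj, mem_moves.2 ⟨j, loc j, ?_, rfl⟩, ?_, ?_, ?_, ?_, ?_⟩
  · rw [ready_iff]
    refine ⟨?_, fun i hi => (ht.flag_iff i).2 (hpred i hi), h.finite j⟩
    rw [← Bool.not_eq_true, ht.flag_iff]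
    exact hj
  · intro i
    rw [flag_move, ht.flag_iff, Finset.mem_insert]
  · intro k hk
    simp only [Finset.mem_insert, not_or] at hk
    rw [readyTime_move, if_neg hk.1]
    have h1 := ht.readyTime_le k hk.2
    cases hc : I.delay j k with
    | none => exact h1
    | some c =>
      have h2 := h.precedence j k c hc
      dsimp only
      generalize (if loc j = loc k then 0 else c) = d at h2 ⊢
      rify at h2
      push_cast
      refine max_le h1 ?_
      have h3 : (0 : ℝ) ≤ d := Nat.cast_nonneg _
      nlinarith
  · intro k hk hl
    simp only [Finset.mem_insert, not_or] at hk
    have h1 := ht.server_le k hk.2 hl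
    rw [server_move]
    cases hlj : loc j with
    | true => exact h1
    | false =>
      -- All remaining server jobs of the plan start after `j` is completed, so the new server time
      -- is still early enough for them.
      have h2 := hnext hlj k hk.2 hk.1 hl
      rify at h2
      rw [hlj] at hF
      rw [hl, cond_false]
      refine hF.trans ?_
      gcongr
      linarith
  · rw [server_move]
    cases hlj : loc j with
    | true => exact ht.server_le_sink
    | false =>
      have h2 := h.le_sink j
      rw [hlj] at hF
      rw [cond_false]
      refine hF.trans ?_
      gcongr
  · rw [cost_move, Finset.sum_insert hj]
    have h1 := ht.cost_le
    have h2 : (0 : ℝ) ≤ (bif loc j then I.time j (loc j) else 0 : ℕ) := Nat.cast_nonneg _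
    push_cast at *
    nlinarith

theorem le_of_roughLe {K a b : ℕ} (hK : 0 < K) (h : roughLe K a b = true) :
    (a : ℝ) ≤ (1 + 1 / K) * b := by
  have h1 : K * a ≤ (K + 1) * b := by simpa [roughLe] using h
  rify at h1
  have h2 : (0 : ℝ) < K := by exact_mod_cast hK
  field_simp
  linarith

theorem Tracks.of_dominates (ht : Tracks loc C r s A)
    (hK : 0 < (I.input L).accuracy) {a : State} (ha : dominates (I.input L) a s = true) :
    Tracks loc C (r * (1 + 1 / (I.input L).accuracy)) a A := by
  obtain ⟨h1, h2, h3⟩ := dominates_iff.1 ha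
  have key : ∀ {a b : ℕ} {y : ℝ}, roughLe (I.input L).accuracy a b = true → (b : ℝ) ≤ r * y →
      (a : ℝ) ≤ r * (1 + 1 / (I.input L).accuracy) * y := by
    intro a b y hab hb
    refine (le_of_roughLe hK hab).trans ?_
    rw [mul_comm r, mul_assoc]
    gcongr
  exact ⟨fun j => by rw [(h1 j).1, ht.flag_iff], fun j hj => key ((h1 j).2 _) (ht.readyTime_le j hj),
    fun j hj hl => key h2 (ht.server_le j hj hl), key h2 ht.server_le_sink, key h3 ht.cost_le⟩

/-- The successor of the tracked state may be trimmed away, but then a kept state dominates it, at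
the price of one factor `1 + 1 / K`. -/
theorem exists_tracks (h : IsPlan loc C) (hK : 0 < (I.input L).accuracy) {m : ℕ} (hm : m ≤ I.n) :
    ∃ s ∈ rounds (I.input L) m, ∃ A : Finset (Fin I.n), A.card = m ∧
      Tracks loc C ((1 + 1 / (I.input L).accuracy : ℝ) ^ m) s A := by
  induction m with
  | zero => exact ⟨_, List.mem_singleton_self _, ∅, rfl, by simpa using tracks_initial h⟩
  | succ m ih =>
    obtain ⟨s, hs, A, hA, ht⟩ := ih (by omega)
    have hr : (1 : ℝ) ≤ (1 + 1 / (I.input L).accuracy : ℝ) ^ m := one_le_pow₀ (by simp)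
    have hA' : A ≠ Finset.univ := by
      rintro rfl
      rw [Finset.card_univ, Fintype.card_fin] at hA
      omega
    obtain ⟨j, hj, hmem, ht'⟩ := ht.exists_move (L := L) h hr hA'
    have hmem' := List.mem_flatMap.2 ⟨s, hs, hmem⟩
    obtain ⟨a, ha, hdom⟩ := (trim_spec (I.input L) _).2.1 _ hmem'
    refine ⟨a, ?_, insert j A, by rw [Finset.card_insert_of_notMem hj, hA], ?_⟩
    · rw [rounds_succ]
      exact ha
    · rw [pow_succ]
      exact ht'.of_dominates hK hdom

end Tracks

theorem accuracy_input : (I.input L).accuracy = 2 * (I.n * L) := rfl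

/-- Apply Bernoulli's inequality to the reciprocal `1 - 1 / (K + 1)` of `1 + 1 / K`: its `n`-th
power is at least `1 - 1 / (2 * L)`, and `(1 + 1 / L) * (1 - 1 / (2 * L)) ≥ 1` for `L ≥ 1`. This is
where the factor `2` in the accuracy is used. -/
theorem one_add_pow_le {n L : ℕ} (hn : 0 < n) (hL : 0 < L) :
    (1 + 1 / ((2 * (n * L) : ℕ) : ℝ)) ^ n ≤ 1 + 1 / L := by
  have hL' : (1 : ℝ) ≤ L := by exact_mod_cast hL
  have hn' : (1 : ℝ) ≤ n := by exact_mod_cast hn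
  set K : ℝ := ((2 * (n * L) : ℕ) : ℝ) with hK
  have hK' : K = 2 * (n * L) := by simp [hK]
  have hKpos : 0 < K := by rw [hK']; positivity
  have h1 : (1 + (n : ℝ) * (-(1 / (K + 1)))) ≤ (1 + -(1 / (K + 1))) ^ n := by
    refine one_add_mul_le_pow ?_ n
    have : 1 / (K + 1) ≤ 1 := by
      rw [div_le_one (by linarith)]
      linarith
    linarith
  have h2 : (1 + 1 / K) ^ n * (1 + -(1 / (K + 1))) ^ n = 1 := by
    rw [← mul_pow]
    have : (1 + 1 / K) * (1 + -(1 / (K + 1))) = 1 := by field_simp; ring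
    rw [this, one_pow]
  have h3 : 1 - 1 / (2 * L : ℝ) ≤ 1 + (n : ℝ) * (-(1 / (K + 1))) := by
    have : (n : ℝ) * (1 / (K + 1)) ≤ 1 / (2 * L) := by
      rw [mul_one_div, div_le_div_iff₀ (by linarith) (by linarith), hK']
      nlinarith
    linarith
  have h4 : 1 ≤ (1 + 1 / (L : ℝ)) * (1 - 1 / (2 * L)) := by
    have : (1 + 1 / (L : ℝ)) * (1 - 1 / (2 * L)) - 1 = (L - 1) / (2 * L ^ 2) := by
      field_simp
      ring
    have h5 : 0 ≤ ((L : ℝ) - 1) / (2 * L ^ 2) := div_nonneg (by linarith) (by positivity)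
    linarith
  have h6 : 0 < 1 - 1 / (2 * L : ℝ) := by
    have : 1 / (2 * L : ℝ) < 1 := by
      rw [div_lt_one (by linarith)]
      linarith
    linarith
  set z := (1 + 1 / K) ^ n
  have hz : 0 ≤ z := by positivity
  by_contra! hlt
  have h7 : z * (1 - 1 / (2 * L : ℝ)) ≤ 1 := by
    exact (mul_le_mul_of_nonneg_left (h3.trans h1) hz).trans h2.le
  have h8 := mul_lt_mul_of_pos_right hlt h6
  linarith

theorem approximatesFront_solve {α : ℝ} (hL : 0 < L) (hα : 1 / (L : ℝ) ≤ α) :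
    I.ApproximatesFront α {p | p ∈ solve (I.input L)} := by
  refine ⟨fun p hp => isPoint_of_mem_solve hp, fun p hp => ?_⟩
  have hn : 0 < I.n := I.sink.pos
  obtain ⟨loc, C, hplan, hC, hcost⟩ := exists_isPlan hp.prop
  obtain ⟨s, hs, A, hA, ht⟩ := exists_tracks (L := L) hplan
    (by rw [accuracy_input]; positivity) le_rfl
  obtain rfl : A = Finset.univ := by
    rw [← Finset.card_eq_iff_eq_univ, hA, Fintype.card_fin]
  have hr : (1 + 1 / (I.input L).accuracy : ℝ) ^ I.n ≤ 1 + α := by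
    rw [accuracy_input]
    exact (one_add_pow_le hn hL).trans (by linarith)
  refine ⟨s.2, ?_, ?_, ?_⟩
  · exact List.mem_map.2 ⟨s, by rwa [length_matrix], rfl⟩
  · refine ht.server_le_sink.trans ?_
    rw [hC]
    gcongr
  · refine ht.cost_le.trans ?_
    rw [hcost]
    gcongr

/-! ### The number of states -/

/-- The number of the geometric interval with ratio `1 + 1 / K` to which a number belongs. -/
noncomputable def cell (K x : ℕ) : ℕ :=
  if x = 0 then 0 else ⌊Real.log x / Real.log (1 + 1 / K)⌋₊ + 1

theorem log_ratio_pos {K : ℕ} (hK : 0 < K) : 0 < Real.log (1 + 1 / K) := by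
  have : (0 : ℝ) < 1 / K := by positivity
  exact Real.log_pos (by linarith)

/-- Logarithms to base `1 + 1 / K` with the same integer part differ by less than one. Zero has a
cell of its own. -/
theorem roughLe_of_cell_eq {K x y : ℕ} (hK : 0 < K) (h : cell K x = cell K y) :
    roughLe K x y = true := by
  have goal : K * x ≤ (K + 1) * y := by
    unfold cell at h
    by_cases hx : x = 0
    · simp [hx]
    · by_cases hy : y = 0
      · simp [hx, hy] at h
      · rw [if_neg hx, if_neg hy] at h
        have hx' : (1 : ℝ) ≤ x := by exact_mod_cast Nat.one_le_iff_ne_zero.2 hx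
        have hy' : (1 : ℝ) ≤ y := by exact_mod_cast Nat.one_le_iff_ne_zero.2 hy
        have hl := log_ratio_pos hK
        have h1 := Nat.floor_le (div_nonneg (Real.log_nonneg hy') hl.le)
        have h2 := Nat.lt_floor_add_one (Real.log x / Real.log (1 + 1 / K))
        rw [Nat.add_right_cancel h] at h2
        have h3 : Real.log x / Real.log (1 + 1 / K) < Real.log y / Real.log (1 + 1 / K) + 1 := by
          linarith
        rw [div_add_one hl.ne', div_lt_div_iff_of_pos_right hl,
          ← Real.log_mul (by positivity) (by positivity)] at h3
        have h4 := (Real.log_lt_log_iff (by positivity) (by positivity)).1 h3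
        have hK' : (0 : ℝ) < K := by exact_mod_cast hK
        have h5 : (K : ℝ) * x ≤ (K + 1) * y := by
          calc (K : ℝ) * x ≤ K * (y * (1 + 1 / K)) := by gcongr
            _ = (K + 1) * y := by field_simp
        exact_mod_cast h5
  simpa [roughLe] using goal

theorem cell_lt {K x B : ℕ} (hK : 0 < K) (h : x < 2 ^ B) : cell K x < B * K + 2 := by
  unfold cell
  split_ifs with hx
  · omega
  · have hl := log_ratio_pos hK
    have hK' : (0 : ℝ) < K := by exact_mod_cast hK
    have h1 : Real.log x ≤ B * Real.log 2 := by
      rw [← Real.log_pow]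
      refine Real.log_le_log (by positivity) ?_
      exact_mod_cast h.le
    -- Bernoulli's inequality gives `(1 + 1 / K) ^ K ≥ 2`, so a doubling spans at most `K` cells.
    have h2 : Real.log 2 ≤ K * Real.log (1 + 1 / K) := by
      rw [← Real.log_pow]
      refine Real.log_le_log (by norm_num) ?_
      have h3 := one_add_mul_le_pow (a := 1 / (K : ℝ)) (by
        have : (0 : ℝ) ≤ 1 / K := by positivity
        linarith) K
      have h4 : (K : ℝ) * (1 / K) = 1 := by field_simp
      linarith
    have h3 : Real.log x / Real.log (1 + 1 / K) ≤ (B * K : ℕ) := by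
      rw [div_le_iff₀ hl]
      push_cast
      nlinarith [(Nat.cast_nonneg B : (0 : ℝ) ≤ B)]
    have h4 := Nat.floor_le_of_le h3
    omega

theorem card_filter_powerset_le {β : Type} [DecidableEq β] (T : Finset β) (k : ℕ) :
    (T.powerset.filter fun X => X.card ≤ k).card ≤ (k + 1) * (T.card + 1) ^ k := by
  have h1 : (T.powerset.filter fun X => X.card ≤ k) ⊆
      (Finset.range (k + 1)).biUnion fun i => T.powersetCard i := by
    intro X hX
    simp only [Finset.mem_filter, Finset.mem_powerset] at hX
    simp only [Finset.mem_biUnion, Finset.mem_range, Finset.mem_powersetCard]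
    exact ⟨X.card, by omega, hX.1, rfl⟩
  refine (Finset.card_le_card h1).trans (Finset.card_biUnion_le.trans ?_)
  refine (Finset.sum_le_card_nsmul _ _ ((T.card + 1) ^ k) fun i hi => ?_).trans (by simp)
  rw [Finset.card_powersetCard]
  refine (Nat.choose_le_pow _ _).trans ?_
  calc T.card ^ i ≤ (T.card + 1) ^ i := by gcongr; omega
    _ ≤ (T.card + 1) ^ k := Nat.pow_le_pow_right (by omega) (by simpa [Nat.lt_succ_iff] using hi)

/-- The jobs scheduled in a state. -/
def scheduled (I : Problem) (s : State) : Finset (Fin I.n) :=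
  Finset.univ.filter fun j => flag s j = true

/-- The signature of a state: the cut between the scheduled and the other jobs, and all numbers
that matter, up to rounding. -/
noncomputable def signature (I : Problem) (K : ℕ) (s : State) :
    Finset ((Fin I.n × Fin I.n) × ℕ × ℕ) × ℕ × ℕ :=
  ((I.cut (scheduled I s)).image fun e =>
    (e, cell K (readyTime s e.2 false), cell K (readyTime s e.2 true)), cell K s.2.1, cell K s.2.2)

theorem Realizes.scheduled_eq {s : State} {A : Finset (Fin I.n)} {loc : Fin I.n → Bool}
    {C : Fin I.n → ℕ} (h : Realizes s A loc C) : scheduled I s = A := by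
  ext j
  simp [scheduled, h.flag_iff]

/-- A minimal element of a nonempty set closed under predecessors has no predecessor at all, hence
is the source. -/
theorem mem_dividingSets {A : Finset (Fin I.n)} (hne : A.Nonempty)
    (hA : ∀ i j, I.Edge i j → j ∈ A → i ∈ A) : A ∈ I.dividingSets := by
  simp only [dividingSets, Finset.mem_filter, Finset.mem_univ, true_and]
  refine ⟨?_, fun j k hjk hj hk => hj (hA j k hjk hk)⟩
  obtain ⟨j, hj, hmin⟩ := wellFounded_edge.has_min (A : Set (Fin I.n)) hne
  by_cases hs : j = I.source
  · exact hs ▸ hj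
  · obtain ⟨i, c, hc⟩ := exists_edge_to hs
    have hij : I.Edge i j := by simp [Edge, hc]
    exact absurd hij (hmin i (hA i j hij hj))

/-- Induction along the edges: if a predecessor of `j` is in both sets and `j` only in `A`, the edge
between them is cut by `B` but not by `A`. -/
theorem mem_of_mem_of_cut_eq {A B : Finset (Fin I.n)} (hA : A ∈ I.dividingSets)
    (hB : B ∈ I.dividingSets) (h : I.cut A = I.cut B) {j : Fin I.n} (hj : j ∈ A) : j ∈ B := by
  simp only [dividingSets, Finset.mem_filter, Finset.mem_univ, true_and] at hA hB
  induction j using wellFounded_edge.induction with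
  | _ j ih =>
    by_cases hs : j = I.source
    · exact hs ▸ hB.1
    · obtain ⟨i, c, hc⟩ := exists_edge_to hs
      have hij : I.Edge i j := by simp [Edge, hc]
      have hi : i ∈ A := by
        by_contra hi
        exact hA.2 i j hij hi hj
      by_contra hjB
      have h1 : (i, j) ∈ I.cut B := by
        simp only [cut, Finset.mem_filter, Finset.mem_univ, true_and]
        exact ⟨hij, ih i hij hi, hjB⟩
      rw [← h] at h1
      simp only [cut, Finset.mem_filter, Finset.mem_univ, true_and] at h1
      exact h1.2.2 hj

theorem dominates_of_signature_eq (hK : 0 < (I.input L).accuracy) {s s' : State}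
    {A A' : Finset (Fin I.n)} {loc loc' : Fin I.n → Bool} {C C' : Fin I.n → ℕ}
    (h : Realizes s A loc C) (h' : Realizes s' A' loc' C') (hne : A.Nonempty) (hne' : A'.Nonempty)
    (hsig : signature I (I.input L).accuracy s = signature I (I.input L).accuracy s') :
    dominates (I.input L) s s' = true := by
  simp only [signature, h.scheduled_eq, h'.scheduled_eq, Prod.mk.injEq] at hsig
  obtain ⟨h1, h2, h3⟩ := hsig
  -- The signature labels every pair of cells with its edge, so the cut can be read off, and with it
  -- the set of scheduled jobs.
  have hcut : I.cut A = I.cut A' := by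
    have := congrArg (Finset.image Prod.fst) h1
    simpa only [Finset.image_image, Function.comp_def, Finset.image_id'] using this
  have hD := mem_dividingSets hne h.closed
  have hD' := mem_dividingSets hne' h'.closed
  obtain rfl : A = A' := by
    ext j
    exact ⟨mem_of_mem_of_cut_eq hD hD' hcut, mem_of_mem_of_cut_eq hD' hD hcut.symm⟩
  rw [dominates_iff]
  refine ⟨fun j => ⟨?_, fun cl => ?_⟩, roughLe_of_cell_eq hK h2, roughLe_of_cell_eq hK h3⟩
  · rw [Bool.eq_iff_iff, h.flag_iff, h'.flag_iff]
  -- Either both ready times vanish in both states, or `j` is the head of a cut edge and its cells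
  -- occur in the signature.
  · by_cases hj : j ∈ A ∨ ∀ i, I.Edge i j → i ∉ A
    · rw [h.readyTime_eq_zero j hj, h'.readyTime_eq_zero j hj]
      exact roughLe_refl _ _
    · push Not at hj
      obtain ⟨hjA, i, hij, hi⟩ := hj
      have hmem : (i, j) ∈ I.cut A := by
        simp only [cut, Finset.mem_filter, Finset.mem_univ, true_and]
        exact ⟨hij, hi, hjA⟩
      have h4 := Finset.mem_image_of_mem (fun e : Fin I.n × Fin I.n =>
        (e, cell (I.input L).accuracy (readyTime s e.2 false),
          cell (I.input L).accuracy (readyTime s e.2 true))) hmem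
      rw [h1] at h4
      obtain ⟨e, -, he⟩ := Finset.mem_image.1 h4
      simp only [Prod.mk.injEq] at he
      obtain ⟨rfl, h5, h6⟩ := he
      cases cl
      · exact roughLe_of_cell_eq hK h5.symm
      · exact roughLe_of_cell_eq hK h6.symm

/-- All numbers in the state `s` are at most `B`. -/
structure Bounded (I : Problem) (B : ℕ) (s : State) : Prop where
  length : s.1.length = I.n
  readyTime : ∀ (j : Fin I.n) cl, readyTime s j cl ≤ B
  server : s.2.1 ≤ B
  cost : s.2.2 ≤ B

/-- A round raises each number by at most one processing time and one delay. -/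
theorem bounded_of_mem_rounds {M : ℕ} (ht : ∀ j cl, I.time j cl ≤ M)
    (hd : ∀ i j c, I.delay i j = some c → c ≤ M) {m : ℕ} {s : State}
    (hs : s ∈ rounds (I.input L) m) : Bounded I (m * (2 * M)) s := by
  induction m generalizing s with
  | zero =>
    obtain rfl : s = initial (I.input L) := by simpa [rounds] using hs
    refine ⟨?_, fun j cl => by simp [readyTime_initial], by simp [initial], by simp [initial]⟩
    simp [initial, Input.jobs, length_matrix]
  | succ m ih =>
    obtain ⟨s, hs', j, cl, -, rfl⟩ := mem_rounds_succ hs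
    have h := ih hs'
    have hF : finish (I.input L) s j cl ≤ m * (2 * M) + M := by
      rw [finish_eq]
      have h1 := h.readyTime j cl
      have h2 := h.server
      have h3 := ht j cl
      cases cl
      · simp only [cond_false]
        omega
      · simp only [cond_true]
        omega
    rw [add_one_mul]
    refine ⟨?_, fun i cl' => ?_, ?_, ?_⟩
    · simp [move, Input.jobs, length_matrix]
    · rw [readyTime_move]
      have h1 := h.readyTime i cl'
      split_ifs with hij
      · omega
      · cases hc : I.delay j i with
        | none =>
          dsimp only
          omega
        | some c =>
          have h2 := hd j i c hc
          exact max_le (by omega) (by omega)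
      · cases hc : I.delay j i with
        | none =>
          dsimp only
          omega
        | some c =>
          have h2 := hd j i c hc
          exact max_le (by omega) (by omega)
    · rw [server_move]
      have h1 := h.server
      cases cl
      · simp only [cond_false]
        omega
      · simp only [cond_true]
        omega
    · rw [cost_move]
      have h1 := h.cost
      have h2 := ht j cl
      cases cl
      · simp only [cond_false]
        omega
      · simp only [cond_true]
        omega

theorem Bounded.esize_le {B : ℕ} {s : State} (h : Bounded I B s) :
    esize s ≤ I.n * (2 * Nat.size B + 7) + 2 * Nat.size B + 5 := by
  have h1 : ∀ a ∈ s.1, esize a ≤ 2 * Nat.size B + 6 := by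
    intro a ha
    obtain ⟨j, hj, rfl⟩ := List.mem_iff_getElem.1 ha
    have h2 := Nat.size_le_size (h.readyTime ⟨j, h.length ▸ hj⟩ false)
    have h3 := Nat.size_le_size (h.readyTime ⟨j, h.length ▸ hj⟩ true)
    have h4 : entry s.1 j = s.1[j] := by
      simp [entry, List.getD_eq_getElem?_getD, hj]
    simp only [ServerCloud.readyTime, h4, cond_false, cond_true] at h2 h3
    have h5 := esize_bool (s.1[j]).1
    simp only [esize_prod, esize_num]
    omega
  have h2 := esize_list_le h1
  have h3 := Nat.size_le_size h.server
  have h4 := Nat.size_le_size h.cost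
  rw [h.length, show 2 * Nat.size B + 6 + 1 = 2 * Nat.size B + 7 from rfl] at h2
  simp only [esize_prod, esize_num]
  omega

theorem signature_mem {k b : ℕ} (hphi : I.phi ≤ k) (hK : 0 < (I.input L).accuracy) {B : ℕ}
    (hB : B < 2 ^ b) {s : State} {A : Finset (Fin I.n)} {loc : Fin I.n → Bool} {C : Fin I.n → ℕ}
    (h : Realizes s A loc C) (hne : A.Nonempty) (hs : Bounded I B s) :
    signature I (I.input L).accuracy s ∈
      ((Finset.univ ×ˢ Finset.range (b * (I.input L).accuracy + 2) ×ˢ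
        Finset.range (b * (I.input L).accuracy + 2)).powerset.filter fun X => X.card ≤ k) ×ˢ
        Finset.range (b * (I.input L).accuracy + 2) ×ˢ
        Finset.range (b * (I.input L).accuracy + 2) := by
  have key : ∀ y ≤ B, cell (I.input L).accuracy y < b * (I.input L).accuracy + 2 := fun y hy =>
    cell_lt hK (lt_of_le_of_lt hy hB)
  simp only [signature, Finset.mem_product, Finset.mem_filter, Finset.mem_powerset,
    Finset.mem_range, h.scheduled_eq]
  refine ⟨⟨?_, ?_⟩, key _ hs.server, key _ hs.cost⟩
  · intro e he
    obtain ⟨e, -, rfl⟩ := Finset.mem_image.1 he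
    simp only [Finset.mem_product, Finset.mem_univ, Finset.mem_range, true_and]
    exact ⟨key _ (hs.readyTime _ _), key _ (hs.readyTime _ _)⟩
  · refine Finset.card_image_le.trans (le_trans ?_ hphi)
    exact Finset.le_sup (f := fun A => (I.cut A).card) (mem_dividingSets hne h.closed)

/-- The signatures of kept states are distinct. Each consists of at most `k` labelled edges, out of
`n ^ 2` edges with two cells each, and of two further cells. -/
theorem length_rounds_le {k b M : ℕ} (hphi : I.phi ≤ k) (hK : 0 < (I.input L).accuracy)
    (ht : ∀ j cl, I.time j cl ≤ M) (hd : ∀ i j c, I.delay i j = some c → c ≤ M) {m : ℕ}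
    (hb : m * (2 * M) < 2 ^ b) : (rounds (I.input L) m).length ≤
      (k + 1) * (I.n ^ 2 * (b * (I.input L).accuracy + 2) ^ 2 + 1) ^ k *
        (b * (I.input L).accuracy + 2) ^ 2 + 1 := by
  cases m with
  -- The empty set of scheduled jobs does not contain the source, so the cut bound does not apply to
  -- it; the single initial state is treated separately.
  | zero => simp [rounds]
  | succ m =>
    have hnodup : ((rounds (I.input L) (m + 1)).map
        (signature I (I.input L).accuracy)).Nodup := by
      have hp : (rounds (I.input L) (m + 1)).Pairwise
          fun b a => dominates (I.input L) a b = false := by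
        rw [rounds_succ]
        exact (trim_spec _ _).2.2
      rw [List.Nodup, List.pairwise_map]
      refine hp.imp_of_mem fun {s s'} hs hs' hdom hsig => ?_
      obtain ⟨A, loc, C, hA, h⟩ := exists_realizes hs
      obtain ⟨A', loc', C', hA', h'⟩ := exists_realizes hs'
      have hne : A.Nonempty := Finset.card_pos.1 (by omega)
      have hne' : A'.Nonempty := Finset.card_pos.1 (by omega)
      rw [dominates_of_signature_eq hK h' h hne' hne hsig.symm] at hdom
      exact absurd hdom (by simp)
    rw [← List.length_map (signature I (I.input L).accuracy),
      ← List.toFinset_card_of_nodup hnodup]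
    refine (Finset.card_le_card (t := ((Finset.univ ×ˢ Finset.range (b * (I.input L).accuracy + 2) ×ˢ
        Finset.range (b * (I.input L).accuracy + 2)).powerset.filter fun X => X.card ≤ k) ×ˢ
        Finset.range (b * (I.input L).accuracy + 2) ×ˢ
        Finset.range (b * (I.input L).accuracy + 2)) fun x hx => ?_).trans ?_
    · obtain ⟨s, hs, rfl⟩ := List.mem_map.1 (List.mem_toFinset.1 hx)
      obtain ⟨A, loc, C, hA, h⟩ := exists_realizes hs
      exact signature_mem hphi hK hb h (Finset.card_pos.1 (by omega))
        (bounded_of_mem_rounds ht hd hs)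
    · rw [Finset.card_product]
      refine (Nat.mul_le_mul_right _ (card_filter_powerset_le _ k)).trans ?_
      simp only [Finset.card_product, Finset.card_univ, Fintype.card_prod, Fintype.card_fin,
        Finset.card_range]
      rw [← sq, ← sq]
      exact Nat.le_succ _

/-! ### The sizes of the numbers in an instance -/

/-! ### Every number of the instance is smaller than two to the length of the input -/

theorem serverTimes_lt (j : Fin I.n) : I.time j false < 2 ^ I.encode.size := by
  refine (Nat.lt_size_self _).trans_le (Nat.pow_le_pow_right (by norm_num) ?_)
  have h1 : esize (I.procS j) < esize (List.ofFn I.procS) :=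
    esize_le_of_mem (List.mem_ofFn.2 ⟨j, rfl⟩)
  have h2 : esize (I.input 0) = I.encode.size + esize (0 : ℕ) + 1 := by
    rw [esize, enc_input]
    rfl
  simp only [input, esize_prod, esize_num, Nat.size_zero] at h1 h2
  have h3 : I.time j false = I.procS j := rfl
  rw [h3]
  omega

theorem cloudTimes_lt (j : Fin I.n) : I.time j true < 2 ^ I.encode.size := by
  refine (Nat.lt_size_self _).trans_le (Nat.pow_le_pow_right (by norm_num) ?_)
  have h1 := esize_le_of_mem (l := List.ofFn fun j => if I.procC j = ⊤ then 0
    else (I.procC j).toNat + 1) (List.mem_ofFn.2 ⟨j, rfl⟩)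
  have h2 : esize (I.input 0) = I.encode.size + esize (0 : ℕ) + 1 := by
    rw [esize, enc_input]
    rfl
  have h3 : I.time j true ≤ if I.procC j = ⊤ then 0 else (I.procC j).toNat + 1 := by
    split_ifs with h
    · simp [time, h]
    · simp [time]
  have h4 := Nat.size_le_size h3
  simp only [input, esize_prod, esize_num, Nat.size_zero] at h1 h2
  omega

theorem delay_lt {i j : Fin I.n} {c : ℕ} (h : I.delay i j = some c) : c < 2 ^ I.encode.size := by
  refine (Nat.lt_size_self _).trans_le (Nat.pow_le_pow_right (by norm_num) ?_)
  have h1 := esize_le_of_mem (List.mem_ofFn.2 ⟨j, rfl⟩ : _ ∈ List.ofFn fun j =>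
    delayCode (I.delay i j))
  have h2 := esize_le_of_mem (List.mem_ofFn.2 ⟨i, rfl⟩ : _ ∈ List.ofFn fun i => List.ofFn fun j =>
    delayCode (I.delay i j))
  have h3 : esize (I.input 0) = I.encode.size + esize (0 : ℕ) + 1 := by
    rw [esize, enc_input]
    rfl
  have h4 : Nat.size c ≤ Nat.size (c + 1) := Nat.size_le_size (Nat.le_succ c)
  have h5 : delayCode (I.delay i j) = c + 1 := by rw [h]; rfl
  simp only [h5, input, esize_prod, esize_num, Nat.size_zero] at h1 h2 h3
  omega

theorem n_lt : I.n < I.encode.size := by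
  have h1 := length_lt_esize (List.ofFn I.procS)
  have h2 : esize (I.input 0) = I.encode.size + esize (0 : ℕ) + 1 := by
    rw [esize, enc_input]
    rfl
  simp only [input, esize_prod, esize_num, Nat.size_zero, List.length_ofFn] at h1 h2
  omega

/-- Instances with bounded maximum cut, together with an accuracy. -/
def BoundedCut (k : ℕ) : Type := {q : Problem × ℕ // q.1.phi ≤ k ∧ 0 < q.2}

instance (k : ℕ) : Enc (BoundedCut k) := ⟨fun q => .pair q.1.1.encode (.num q.1.2)⟩

theorem exists_esize_rounds_le (k : ℕ) : ∃ Q : ℕ[X], ∀ I : Problem, ∀ L : ℕ, I.phi ≤ k → 0 < L →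
    ∀ m ≤ I.n, esize (rounds (I.input L) m) ≤ Q.eval (I.encode.size + L + 2) := by
  -- This bounds the number of cells `b * K + 2`, with `b = 2 * μ + 1` and `K = 2 * (n * L) ≤ 2 * (μ
  -- * μ)`.
  let p : ℕ[X] := (2 * X + 1) * (2 * (X * X)) + 2
  refine ⟨(C (k + 1) * (X ^ 2 * p ^ 2 + 1) ^ k * p ^ 2 + 1) *
    (X * (2 * (2 * X + 1) + 7) + 2 * (2 * X + 1) + 5 + 1) + 1, fun I L hphi hL m hm => ?_⟩
  set μ := I.encode.size + L + 2 with hμ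
  have hnμ : I.n ≤ μ := by have := n_lt (I := I); omega
  have hLμ : L ≤ μ := by omega
  have hK : 0 < (I.input L).accuracy := by
    have := I.sink.pos
    rw [accuracy_input]
    positivity
  have hKμ : (I.input L).accuracy ≤ 2 * (μ * μ) := by
    rw [accuracy_input]
    gcongr
  have hpow : 2 ^ I.encode.size ≤ 2 ^ μ := Nat.pow_le_pow_right (by norm_num) (by omega)
  have ht : ∀ j cl, I.time j cl ≤ 2 ^ μ := fun j cl => by
    cases cl
    · exact (serverTimes_lt j).le.trans hpow
    · exact (cloudTimes_lt j).le.trans hpow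
  have hd : ∀ i j c, I.delay i j = some c → c ≤ 2 ^ μ := fun i j c h => (delay_lt h).le.trans hpow
  have hb : m * (2 * 2 ^ μ) < 2 ^ (2 * μ + 1) := by
    have h1 : m < 2 ^ μ := lt_of_le_of_lt (hm.trans hnμ) Nat.lt_two_pow_self
    have h2 : 2 ^ (2 * μ + 1) = 2 ^ μ * (2 * 2 ^ μ) := by ring
    rw [h2]
    exact Nat.mul_lt_mul_of_pos_right h1 (by positivity)
  have h1 := length_rounds_le hphi hK ht hd hb
  have h2 : ∀ s ∈ rounds (I.input L) m,
      esize s ≤ μ * (2 * (2 * μ + 1) + 7) + 2 * (2 * μ + 1) + 5 := by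
    intro s hs
    refine (bounded_of_mem_rounds ht hd hs).esize_le.trans ?_
    have h3 : Nat.size (m * (2 * 2 ^ μ)) ≤ 2 * μ + 1 := Nat.size_le.2 hb
    gcongr
  refine (esize_list_le h2).trans ?_
  simp only [p, eval_add, eval_mul, eval_pow, eval_C, eval_X, eval_one, eval_ofNat]
  gcongr
  refine h1.trans ?_
  gcongr

end ServerCloud

/-! ### Conclusion -/

theorem mainTheorem10 (k : ℕ) :
    ∃ (A : Prog) (P : Polynomial ℕ),
      ∀ (I : ServerCloud.Problem) (α : ℝ), I.phi ≤ k → 0 < α →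
        ∃ (S : List (ℕ × ℕ)) (t : ℕ),
          A.Runs (.pair I.encode (.num ⌈1 / α⌉₊)) (ServerCloud.encodePoints S) t ∧
          t ≤ P.eval (I.encode.size + ⌈1 / α⌉₊) ∧
          I.ApproximatesFront α {p | p ∈ S} := by
  obtain ⟨Q, hQ⟩ := ServerCloud.exists_esize_rounds_le k
  obtain ⟨A, P, hA⟩ := ServerCloud.PTm.solve (α := ServerCloud.BoundedCut k)
    (e := fun q => q.1.1.input q.1.2) (μ := fun q => q.1.1.encode.size + q.1.2 + 2)
    (fun q => ServerCloud.Problem.enc_input q.1.2)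
    (fun q => by
      have := Nat.size_le_self q.1.2
      simp only [esize, Enc.enc, Val.size]
      omega) Q
    (fun q m hm => hQ q.1.1 q.1.2 q.2.1 q.2.2 m
      (by rwa [ServerCloud.Problem.length_matrix] at hm))
  -- The shift by `2` pays for the pair node and the constant `1` in the size of the number `⌈1 /
  -- α⌉₊`.
  refine ⟨A, P.comp (X + 2), fun I α hphi hα => ?_⟩
  have hL : 0 < ⌈1 / α⌉₊ := Nat.ceil_pos.2 (by positivity)
  obtain ⟨t, h1, h2⟩ := hA ⟨(I, ⌈1 / α⌉₊), hphi, hL⟩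
  refine ⟨_, t, h1, ?_, ServerCloud.approximatesFront_solve hL ?_⟩
  · simpa using h2
  · have := Nat.le_ceil (1 / α)
    rw [div_le_comm₀ (by exact_mod_cast hL) hα]
    exact this
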